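/- All rings are associative with unit, and all modules are unital. Let $A$ and $B$ be rings and let ${}_B\Sigma_A$ be a $(B,A)$-bimodule such that ${}_B\Sigma$ is faithful and $\Sigma_A$ is finitely generated and projective. Put $\Sigma^*=\mathrm{Hom}(\Sigma_A,A_A)$, an $(A,B)$-bimodule via $(afb)(x)=a\,f(bx)$, and $S=\mathrm{End}(\Sigma_A)$; since ${}_B\Sigma$ is faithful, $B$ is identified with a subring of $S$. Let $\{(e_i,e_i^*)\}_i$ be a finite dual basis of $\Sigma_A$, so that $x=\sum_i e_i e_i^*(x)$ for all $x\in\Sigma$. Let $\mathfrak C=\Sigma^*\otimes_B\Sigma$ be the comatrix $A$-coring, with comultiplication $\Delta(f\otimes u)=\sum_i (f\otimes e_i)\otimes_A(e_i^*\otimes u)$ and counit $\varepsilon(f\otimes u)=f(u)$ (it does not depend on the dual basis), and let $\mathrm{End}_{A\text{-cor}}(\mathfrak C)$ be the monoid, under composition, of the $A$-coring endomorphisms of $\mathfrak C$. The right $A$-module $\Sigma$ is a right $\mathfrak C$-comodule via $\rho(u)=\sum_i e_i\otimes_A(e_i^*\otimes_B u)$; for a coring endomorphism $g$ let $\Sigma_g$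 be $\Sigma$ with the coaction $(\Sigma\otimes_A g)\circ\rho$, and let $\mathrm{Hom}_{\mathfrak C}(\Sigma_g,\Sigma)\subseteq S$ be the set of right $\mathfrak C$-colinear maps $\Sigma_g\to\Sigma$, which is a $B$-sub-bimodule of $S$. The $B$-sub-bimodules of $S$ form a monoid under the product $IJ=\{\text{finite sums of } xy : x\in I,\ y\in J\}$ with unit $B$; let $\mathbf I^l_B(S)$ be its submonoid of those $I$ for which the multiplication map $\mathbf m:S\otimes_B I\to S$, $s\otimes x\mapsto sx$, is bijective. Assume that either (a) the right $B$-module $\Sigma^*_B$ is faithfully flat, or (b) ${}_B\Sigma_A$ is a separable bimodule, that is, the evaluation map $\Sigma\otimes_A{}^*\Sigma\to B$, $x\otimes\varphi\mapsto\varphi(x)$, where ${}^*\Sigma=\mathrm{Hom}({}_B\Sigma,{}_BB)$, is a split epimorphism of $B$-bimodules. Then $$\digamma^l:\ \mathrm{End}_{A\text{-cor}}(\mathfrak C)\longrightarrow \mathbf I^l_B(S),\qquad g\longmapsto \mathrm{Hom}_{\mathfrak C}(\Sigma_g,\Sigma),$$ is a well-defined isomorphism of monoids. Its inverse $\Gamma^l$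 sends $I\in\mathbf I^l_B(S)$ to the coring endomorphism $$\Gamma^l(I):\ u^*\otimes_B u\longmapsto \sum_k u^*s_k\otimes_B x_k u,\qquad\text{where } \mathbf m^{-1}(1)=\sum_k s_k\otimes_B x_k\in S\otimes_B I.$$ -/

import Mathlib

namespace Comatrix

open MulOpposite

/-! Conventions. A right `R`-module is a `Module Rᵐᵒᵖ M`, so `m r` is `op r • m`.  A `(B, A)`-bimodule
is an abelian group with `Module B M`, `Module Aᵐᵒᵖ M` and `SMulCommClass Aᵐᵒᵖ B M`. -/

universe u v w

/-! ### The tensor product over a noncommutative ring -/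

section Tensor

/-- The subgroup of `M ⊗[ℤ] N` generated by the elements `m r ⊗ n - m ⊗ r n`. -/
def balancedRelations (R M N : Type*) [Ring R] [AddCommGroup M] [Module Rᵐᵒᵖ M]
    [AddCommGroup N] [Module R N] : AddSubgroup (TensorProduct ℤ M N) :=
  AddSubgroup.closure
    {t | ∃ (m : M) (r : R) (n : N),
      t = TensorProduct.tmul ℤ (op r • m) n - TensorProduct.tmul ℤ m (r • n)}

/-- The tensor product `M ⊗_R N` of a right `R`-module and a left `R`-module. -/
def NTensor (R M N : Type*) [Ring R] [AddCommGroup M] [Module Rᵐᵒᵖ M]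
    [AddCommGroup N] [Module R N] : Type _ :=
  TensorProduct ℤ M N ⧸ balancedRelations R M N

namespace NTensor

section Basic

variable (R : Type*) {M N : Type*} [Ring R] [AddCommGroup M] [Module Rᵐᵒᵖ M]
  [AddCommGroup N] [Module R N]

instance : AddCommGroup (NTensor R M N) :=
  inferInstanceAs (AddCommGroup (TensorProduct ℤ M N ⧸ balancedRelations R M N))

/-- The quotient map `M ⊗[ℤ] N → M ⊗_R N`. -/
def proj : TensorProduct ℤ M N →+ NTensor R M N :=
  QuotientAddGroup.mk' (balancedRelations R M N)

/-- The pure tensor `m ⊗ n` in `M ⊗_R N`. -/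
def tmul (m : M) (n : N) : NTensor R M N :=
  proj R (TensorProduct.tmul ℤ m n)

theorem add_tmul (m m' : M) (n : N) : tmul R (m + m') n = tmul R m n + tmul R m' n := by
  simp only [tmul, TensorProduct.add_tmul, map_add]

theorem tmul_add (m : M) (n n' : N) : tmul R m (n + n') = tmul R m n + tmul R m n' := by
  simp only [tmul, TensorProduct.tmul_add, map_add]

theorem smul_tmul (m : M) (r : R) (n : N) : tmul R (op r • m) n = tmul R m (r • n) := by
  rw [← sub_eq_zero, tmul, tmul, ← map_sub]
  exact (QuotientAddGroup.eq_zero_iff _).2 (AddSubgroup.subset_closure ⟨m, r, n, rfl⟩)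

/-- The biadditive map `(m, n) ↦ m ⊗ n`. -/
def mk : M →+ N →+ NTensor R M N :=
  AddMonoidHom.mk' (fun m => AddMonoidHom.mk' (fun n => tmul R m n) (tmul_add R m))
    fun m m' => AddMonoidHom.ext fun n => add_tmul R m m' n

@[simp] theorem mk_apply (m : M) (n : N) : mk R m n = tmul R m n := rfl

@[simp] theorem zero_tmul (n : N) : tmul R (0 : M) n = 0 := by
  rw [← mk_apply, map_zero, AddMonoidHom.zero_apply]

@[simp] theorem tmul_zero (m : M) : tmul R m (0 : N) = 0 := by
  rw [← mk_apply, map_zero]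

theorem sum_tmul {κ : Type*} (s : Finset κ) (f : κ → M) (n : N) :
    tmul R (∑ i ∈ s, f i) n = ∑ i ∈ s, tmul R (f i) n := by
  rw [← mk_apply, map_sum, AddMonoidHom.finsetSum_apply]; rfl

theorem tmul_sum {κ : Type*} (s : Finset κ) (m : M) (f : κ → N) :
    tmul R m (∑ i ∈ s, f i) = ∑ i ∈ s, tmul R m (f i) := by
  rw [← mk_apply, map_sum]; rfl

variable {R}

/-- The universal property: balanced biadditive maps factor through `M ⊗_R N`. -/
def lift {P : Type*} [AddCommGroup P] (f : M →+ N →+ P)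
    (hf : ∀ (m : M) (r : R) (n : N), f (op r • m) n = f m (r • n)) : NTensor R M N →+ P :=
  QuotientAddGroup.lift (balancedRelations R M N)
    (TensorProduct.liftAddHom (R := ℤ) f fun z m n => by
      rw [map_zsmul, map_zsmul, AddMonoidHom.smul_apply]) <| by
    rw [balancedRelations, AddSubgroup.closure_le]
    rintro _ ⟨m, r, n, rfl⟩
    simp [hf]

@[simp] theorem lift_tmul {P : Type*} [AddCommGroup P] (f : M →+ N →+ P)
    (hf : ∀ (m : M) (r : R) (n : N), f (op r • m) n = f m (r • n)) (m : M) (n : N) :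
    lift f hf (tmul R m n) = f m n := rfl

@[elab_as_elim]
theorem induction_on {p : NTensor R M N → Prop} (z : NTensor R M N) (zero : p 0)
    (tmul : ∀ m n, p (tmul R m n)) (add : ∀ x y, p x → p y → p (x + y)) : p z := by
  obtain ⟨t, rfl⟩ := QuotientAddGroup.mk'_surjective (balancedRelations R M N) z
  induction t using TensorProduct.induction_on with
  | zero => exact zero
  | tmul m n => exact tmul m n
  | add x y hx hy => rw [map_add]; exact add _ _ hx hy

theorem hom_ext {P : Type*} [AddCommGroup P] {f g : NTensor R M N →+ P}
    (h : ∀ m n, f (tmul R m n) = g (tmul R m n)) : f = g := by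
  ext z
  induction z using induction_on with
  | zero => simp
  | tmul m n => exact h m n
  | add x y hx hy => rw [map_add, map_add, hx, hy]

variable {M' N' M'' N'' : Type*} [AddCommGroup M'] [Module Rᵐᵒᵖ M'] [AddCommGroup N'] [Module R N']
  [AddCommGroup M''] [Module Rᵐᵒᵖ M''] [AddCommGroup N''] [Module R N'']

/-- The map `f ⊗ g`. -/
def map (f : M →ₗ[Rᵐᵒᵖ] M') (g : N →ₗ[R] N') : NTensor R M N →+ NTensor R M' N' :=
  lift (AddMonoidHom.mk' (fun m => (mk R (f m)).comp g.toAddMonoidHom) fun m m' => by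
      ext n; simp) fun m r n => by
    simp [smul_tmul]

@[simp] theorem map_tmul (f : M →ₗ[Rᵐᵒᵖ] M') (g : N →ₗ[R] N') (m : M) (n : N) :
    map f g (tmul R m n) = tmul R (f m) (g n) := rfl

theorem map_map (f' : M' →ₗ[Rᵐᵒᵖ] M'') (g' : N' →ₗ[R] N'') (f : M →ₗ[Rᵐᵒᵖ] M') (g : N →ₗ[R] N')
    (z : NTensor R M N) : map f' g' (map f g z) = map (f' ∘ₗ f) (g' ∘ₗ g) z := by
  induction z using induction_on with
  | zero => simp
  | tmul m n => rfl
  | add x y hx hy => simp only [map_add, hx, hy]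

@[simp] theorem map_id (z : NTensor R M N) :
    map (LinearMap.id : M →ₗ[Rᵐᵒᵖ] M) (LinearMap.id : N →ₗ[R] N) z = z := by
  induction z using induction_on with
  | zero => simp
  | tmul m n => rfl
  | add x y hx hy => simp only [map_add, hx, hy]

/-- The canonical map `R ⊗_R N → N`, `r ⊗ n ↦ r n`. -/
def lid : NTensor R R N →+ N :=
  lift (AddMonoidHom.mk' (fun r => AddMonoidHom.mk' (fun n => r • n) (smul_add r))
    fun r r' => by ext n; exact add_smul r r' n) fun a r n => by
      simp [mul_smul]

@[simp] theorem lid_tmul (r : R) (n : N) : lid (tmul R r n) = r • n := rfl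

/-- The canonical map `M ⊗_R R → M`, `m ⊗ r ↦ m r`. -/
def rid : NTensor R M R →+ M :=
  lift (AddMonoidHom.mk' (fun m => AddMonoidHom.mk' (fun r => op r • m)
      fun r r' => by rw [op_add, add_smul])
    fun m m' => by ext r; exact smul_add (op r) m m') fun m r a => by
      simp [mul_smul]

@[simp] theorem rid_tmul (m : M) (r : R) : rid (tmul R m r) = op r • m := rfl

end Basic

section Actions

variable {R : Type*} {M N : Type*} [Ring R] [AddCommGroup M] [Module Rᵐᵒᵖ M]
  [AddCommGroup N] [Module R N]

/-- The left action on `M ⊗_R N` induced by a left action on `M`: `t (m ⊗ n) = t m ⊗ n`. -/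
instance (priority := 90) instModuleLeft {T : Type*} [Ring T] [Module T M]
    [SMulCommClass Rᵐᵒᵖ T M] : Module T (NTensor R M N) where
  smul t := map { toFun := fun m => t • m, map_add' := smul_add t,
                  map_smul' := fun r m => (smul_comm r t m).symm } LinearMap.id
  one_smul z := by
    change map _ _ z = z
    induction z using induction_on with
    | zero => simp
    | tmul m n => simp
    | add x y hx hy => simp only [map_add, hx, hy]
  mul_smul s t z := by
    change map _ _ z = map _ _ (map _ _ z)
    induction z using induction_on with
    | zero => simp
    | tmul m n => simp [mul_smul]
    | add x y hx hy => simp only [map_add, hx, hy]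
  smul_zero t := map_zero _
  smul_add t := map_add _
  add_smul s t z := by
    change map _ _ z = map _ _ z + map _ _ z
    induction z using induction_on with
    | zero => simp
    | tmul m n => simp [add_smul, add_tmul]
    | add x y hx hy => simp only [map_add, hx, hy]; abel
  zero_smul z := by
    change map _ _ z = 0
    induction z using induction_on with
    | zero => simp
    | tmul m n => simp
    | add x y hx hy => simp only [map_add, hx, hy, add_zero]

/-- The right action on `M ⊗_R N` induced by a right action on `N`: `(m ⊗ n) t = m ⊗ n t`. -/
instance (priority := 95) instModuleRight {T : Type*} [Ring T] [Module Tᵐᵒᵖ N]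
    [SMulCommClass Tᵐᵒᵖ R N] : Module Tᵐᵒᵖ (NTensor R M N) where
  smul t := map LinearMap.id { toFun := fun n => t • n, map_add' := smul_add t,
                               map_smul' := fun r n => smul_comm t r n }
  one_smul z := by
    change map _ _ z = z
    induction z using induction_on with
    | zero => simp
    | tmul m n => simp
    | add x y hx hy => simp only [map_add, hx, hy]
  mul_smul s t z := by
    change map _ _ z = map _ _ (map _ _ z)
    induction z using induction_on with
    | zero => simp
    | tmul m n => simp [mul_smul]
    | add x y hx hy => simp only [map_add, hx, hy]
  smul_zero t := map_zero _
  smul_add t := map_add _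
  add_smul s t z := by
    change map _ _ z = map _ _ z + map _ _ z
    induction z using induction_on with
    | zero => simp
    | tmul m n => simp [add_smul, tmul_add]
    | add x y hx hy => simp only [map_add, hx, hy]; abel
  zero_smul z := by
    change map _ _ z = 0
    induction z using induction_on with
    | zero => simp
    | tmul m n => simp
    | add x y hx hy => simp only [map_add, hx, hy, add_zero]

@[simp] theorem left_smul_tmul {T : Type*} [Ring T] [Module T M] [SMulCommClass Rᵐᵒᵖ T M]
    (t : T) (m : M) (n : N) : t • tmul R m n = tmul R (t • m) n := rfl

theorem right_smul_tmul {T : Type*} [Ring T] [Module Tᵐᵒᵖ N] [SMulCommClass Tᵐᵒᵖ R N]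
    (t : T) (m : M) (n : N) : op t • tmul R m n = tmul R m (op t • n) := rfl

instance (priority := 90) instSMulComm {T U : Type*} [Ring T] [Module T M] [SMulCommClass Rᵐᵒᵖ T M]
    [Ring U] [Module Uᵐᵒᵖ N] [SMulCommClass Uᵐᵒᵖ R N] :
    SMulCommClass Uᵐᵒᵖ T (NTensor R M N) := by
  refine ⟨fun s t z => ?_⟩
  induction z using induction_on with
  | zero => simp only [smul_zero]
  | tmul m n => rfl
  | add x y hx hy => simp only [smul_add, hx, hy]

end Actions

section Assoc

variable {R T : Type*} {M N P : Type*} [Ring R] [Ring T] [AddCommGroup M] [Module Rᵐᵒᵖ M]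
  [AddCommGroup N] [Module R N] [Module Tᵐᵒᵖ N] [SMulCommClass Tᵐᵒᵖ R N]
  [AddCommGroup P] [Module T P]

/-- The canonical map `(M ⊗_R N) ⊗_T P → M ⊗_R (N ⊗_T P)`. -/
def assoc : NTensor T (NTensor R M N) P →+ NTensor R M (NTensor T N P) :=
  lift
    (lift
      (AddMonoidHom.mk' (fun m => AddMonoidHom.mk' (fun n => (mk R m).comp (mk T n)) fun n n' => by
          ext p; simp [tmul_add]) fun m m' => by
        ext n p; simp)
      fun m r n => by
        ext p
        exact smul_tmul R m r (tmul T n p))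
    fun z t p => by
      induction z using induction_on with
      | zero => simp only [smul_zero, map_zero, AddMonoidHom.zero_apply]
      | tmul m n =>
        change tmul R m (tmul T (op t • n) p) = tmul R m (tmul T n (t • p))
        rw [smul_tmul]
      | add x y hx hy => simp only [smul_add, map_add, AddMonoidHom.add_apply, hx, hy]

@[simp] theorem assoc_tmul (m : M) (n : N) (p : P) :
    assoc (tmul T (tmul R m n) p) = tmul R m (tmul T n p) := rfl

end Assoc

end NTensor

end Tensor

/-! ### Bimodule maps, flatness -/

/-- A homomorphism of `(R, T)`-bimodules. -/
structure BimoduleHom (R T M N : Type*) [Ring R] [Ring T] [AddCommGroup M] [Module R M]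
    [Module Tᵐᵒᵖ M] [AddCommGroup N] [Module R N] [Module Tᵐᵒᵖ N] extends M →ₗ[R] N where
  map_op_smul' : ∀ (t : T) (m : M), toFun (op t • m) = op t • toFun m

namespace BimoduleHom

variable {R T M N P : Type*} [Ring R] [Ring T] [AddCommGroup M] [Module R M] [Module Tᵐᵒᵖ M]
  [AddCommGroup N] [Module R N] [Module Tᵐᵒᵖ N] [AddCommGroup P] [Module R P] [Module Tᵐᵒᵖ P]

instance : CoeFun (BimoduleHom R T M N) fun _ => M → N := ⟨fun f => f.toLinearMap⟩

/-- The underlying left linear map. -/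
abbrev left (f : BimoduleHom R T M N) : M →ₗ[R] N := f.toLinearMap

/-- The underlying right linear map. -/
def right (f : BimoduleHom R T M N) : M →ₗ[Tᵐᵒᵖ] N where
  toFun := f
  map_add' := map_add f.toLinearMap
  map_smul' t m := f.map_op_smul' (unop t) m

@[simp] theorem right_apply (f : BimoduleHom R T M N) (m : M) : f.right m = f m := rfl

@[ext] theorem ext {f g : BimoduleHom R T M N} (h : ∀ m, f m = g m) : f = g := by
  cases f; cases g; congr; exact LinearMap.ext h

/-- The identity. -/
def id : BimoduleHom R T M M where
  toLinearMap := LinearMap.id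
  map_op_smul' _ _ := rfl

/-- The composite `g ∘ f`. -/
def comp (g : BimoduleHom R T N P) (f : BimoduleHom R T M N) : BimoduleHom R T M P where
  toLinearMap := g.left ∘ₗ f.left
  map_op_smul' t m := by
    change g.right (f.right (op t • m)) = op t • g.right (f.right m)
    rw [map_smul, map_smul]

end BimoduleHom

/-- `M_R` is flat: `M ⊗_R -` preserves injectivity of left `R`-linear maps. -/
def RightFlat (R : Type u) (M : Type v) [Ring R] [AddCommGroup M] [Module Rᵐᵒᵖ M] : Prop :=
  ∀ (N N' : Type (max u v)) [AddCommGroup N] [Module R N] [AddCommGroup N'] [Module R N']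
    (f : N →ₗ[R] N'), Function.Injective f →
      Function.Injective (NTensor.map (LinearMap.id : M →ₗ[Rᵐᵒᵖ] M) f)

/-- `M_R` is faithfully flat: it is flat, and `M ⊗_R N = 0` implies `N = 0`. -/
def RightFaithfullyFlat (R : Type u) (M : Type v) [Ring R] [AddCommGroup M] [Module Rᵐᵒᵖ M] :
    Prop :=
  RightFlat R M ∧ ∀ (N : Type (max u v)) [AddCommGroup N] [Module R N],
    Subsingleton (NTensor R M N) → Subsingleton N

/-! ### Corings and comodules -/

section Coring

/-- The structure of an `A`-coring on an `A`-bimodule `C`. -/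
structure Coring (A C : Type*) [Ring A] [AddCommGroup C] [Module A C] [Module Aᵐᵒᵖ C]
    [SMulCommClass Aᵐᵒᵖ A C] where
  /-- The comultiplication. -/
  comul : BimoduleHom A A C (NTensor A C C)
  /-- The counit. -/
  counit : BimoduleHom A A C A
  coassoc : ∀ c, NTensor.assoc (NTensor.map comul.right LinearMap.id (comul c)) =
    NTensor.map LinearMap.id comul.left (comul c)
  counit_left : ∀ c, NTensor.lid (NTensor.map counit.right LinearMap.id (comul c)) = c
  counit_right : ∀ c, NTensor.rid (NTensor.map LinearMap.id counit.left (comul c)) = c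

variable {A C D M N P : Type*} [Ring A]
  [AddCommGroup C] [Module A C] [Module Aᵐᵒᵖ C] [SMulCommClass Aᵐᵒᵖ A C]
  [AddCommGroup D] [Module A D] [Module Aᵐᵒᵖ D] [SMulCommClass Aᵐᵒᵖ A D]
  [AddCommGroup M] [Module Aᵐᵒᵖ M] [AddCommGroup N] [Module Aᵐᵒᵖ N] [AddCommGroup P] [Module Aᵐᵒᵖ P]

/-- A morphism of `A`-corings. -/
structure CoringHom (𝒞 : Coring A C) (𝒟 : Coring A D) extends BimoduleHom A A C D where
  counit_comp : ∀ c, 𝒟.counit (toBimoduleHom c) = 𝒞.counit c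
  comul_comp : ∀ c, 𝒟.comul (toBimoduleHom c) =
    NTensor.map toBimoduleHom.right toBimoduleHom.left (𝒞.comul c)

namespace CoringHom

instance (𝒞 : Coring A C) (𝒟 : Coring A D) : CoeFun (CoringHom 𝒞 𝒟) fun _ => C → D :=
  ⟨fun f => f.toBimoduleHom⟩

@[ext] theorem ext {𝒞 : Coring A C} {𝒟 : Coring A D} {f g : CoringHom 𝒞 𝒟}
    (h : ∀ c, f c = g c) : f = g := by
  cases f; cases g; congr; exact BimoduleHom.ext h

/-- The monoid of coring endomorphisms, with `g * h = g ∘ h`. -/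
instance (𝒞 : Coring A C) : Monoid (CoringHom 𝒞 𝒞) where
  one := { toBimoduleHom := BimoduleHom.id
           counit_comp := fun _ => rfl
           comul_comp := fun c => (NTensor.map_id _).symm }
  mul g h := { toBimoduleHom := g.toBimoduleHom.comp h.toBimoduleHom
               counit_comp := fun c => (g.counit_comp _).trans (h.counit_comp c)
               comul_comp := fun c => (g.comul_comp _).trans <| by
                 rw [h.comul_comp, NTensor.map_map]; rfl }
  mul_assoc _ _ _ := rfl
  one_mul _ := rfl
  mul_one _ := rfl

theorem one_apply (𝒞 : Coring A C) (c : C) : (1 : CoringHom 𝒞 𝒞) c = c := rfl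

theorem mul_apply (𝒞 : Coring A C) (g h : CoringHom 𝒞 𝒞) (c : C) : (g * h) c = g (h c) := rfl

end CoringHom

/-- The structure of a right `𝒞`-comodule on a right `A`-module `M`. -/
structure RightComodule (𝒞 : Coring A C) (M : Type*) [AddCommGroup M] [Module Aᵐᵒᵖ M] where
  /-- The coaction. -/
  coact : M →ₗ[Aᵐᵒᵖ] NTensor A M C
  coassoc : ∀ m, NTensor.assoc (NTensor.map coact LinearMap.id (coact m)) =
    NTensor.map LinearMap.id 𝒞.comul.left (coact m)
  counit : ∀ m, NTensor.rid (NTensor.map LinearMap.id 𝒞.counit.left (coact m)) = m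

/-- A right `A`-linear map between right comodules is colinear if it commutes with the coactions. -/
def IsColinear {𝒞 : Coring A C} (X : RightComodule 𝒞 M) (Y : RightComodule 𝒞 N)
    (t : M →ₗ[Aᵐᵒᵖ] N) : Prop :=
  ∀ m, Y.coact (t m) = NTensor.map t LinearMap.id (X.coact m)

theorem IsColinear.comp {𝒞 : Coring A C} {X : RightComodule 𝒞 M} {Y : RightComodule 𝒞 N}
    {Z : RightComodule 𝒞 P} {s : N →ₗ[Aᵐᵒᵖ] P} {t : M →ₗ[Aᵐᵒᵖ] N} (hs : IsColinear Y Z s)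
    (ht : IsColinear X Y t) : IsColinear X Z (s ∘ₗ t) := fun m => by
  rw [LinearMap.comp_apply, hs, ht, NTensor.map_map]; rfl

/-- The map `(X ⊗ g) ∘ ρ_X`. -/
def RightComodule.inducedCoact {𝒞 : Coring A C} (X : RightComodule 𝒞 M) (g : CoringHom 𝒞 𝒞) :
    M →ₗ[Aᵐᵒᵖ] NTensor A M C where
  toFun := fun m => NTensor.map LinearMap.id g.left (X.coact m)
  map_add' := fun m m' => by rw [map_add, map_add]
  map_smul' := fun a m => by
    rw [map_smul]
    generalize X.coact m = z
    induction z using NTensor.induction_on with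
    | zero => simp only [smul_zero, map_zero]
    | tmul m c => exact congrArg (NTensor.tmul A m) (map_smul g.right a c)
    | add x y hx hy => simp only [smul_add, map_add, hx, hy]

/-- The comodule `X_g` with coaction `(X ⊗ g) ∘ ρ_X` induced by a coring endomorphism `g`. -/
def RightComodule.induced {𝒞 : Coring A C} (X : RightComodule 𝒞 M) (g : CoringHom 𝒞 𝒞) :
    RightComodule 𝒞 M where
  coact := X.inducedCoact g
  coassoc m := by
    let G : NTensor A C C →ₗ[A] NTensor A C C :=
      { toFun := NTensor.map g.right g.left
        map_add' := map_add _
        map_smul' := fun a z => by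
          induction z using NTensor.induction_on with
          | zero => simp only [smul_zero, map_zero]
          | tmul c d => exact congrArg (fun c => NTensor.tmul A c (g d)) (map_smul g.left a c)
          | add x y hx hy => simp only [smul_add, map_add, hx, hy] }
    have h₁ : ∀ z : NTensor A M C,
        NTensor.assoc (NTensor.map (X.inducedCoact g) g.left z) =
          NTensor.map LinearMap.id G (NTensor.assoc (NTensor.map X.coact LinearMap.id z)) := by
      intro z
      induction z using NTensor.induction_on with
      | zero => simp only [map_zero]
      | add x y hx hy => simp only [map_add, hx, hy]
      | tmul m c =>
        change NTensor.assoc (NTensor.tmul A (NTensor.map LinearMap.id g.left (X.coact m)) (g c)) =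
          NTensor.map LinearMap.id G (NTensor.assoc (NTensor.tmul A (X.coact m) c))
        generalize X.coact m = y
        induction y using NTensor.induction_on with
        | zero => simp only [map_zero, NTensor.zero_tmul]
        | add x y hx hy => simp only [map_add, NTensor.add_tmul, hx, hy]
        | tmul m d => rfl
    have h₂ : G ∘ₗ 𝒞.comul.left = 𝒞.comul.left ∘ₗ g.left :=
      LinearMap.ext fun c => (g.comul_comp c).symm
    change NTensor.assoc (NTensor.map (X.inducedCoact g) LinearMap.id
      (NTensor.map LinearMap.id g.left (X.coact m))) =
        NTensor.map LinearMap.id 𝒞.comul.left (NTensor.map LinearMap.id g.left (X.coact m))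
    rw [NTensor.map_map, NTensor.map_map, LinearMap.comp_id, LinearMap.id_comp, h₁, X.coassoc,
      NTensor.map_map, h₂]
  counit m := by
    change NTensor.rid (NTensor.map LinearMap.id 𝒞.counit.left
      (NTensor.map LinearMap.id g.left (X.coact m))) = m
    rw [NTensor.map_map]
    have h : 𝒞.counit.left ∘ₗ g.left = 𝒞.counit.left := LinearMap.ext g.counit_comp
    rw [h]
    exact X.counit m

theorem IsColinear.induced {𝒞 : Coring A C} {X : RightComodule 𝒞 M} {Y : RightComodule 𝒞 N}
    {t : M →ₗ[Aᵐᵒᵖ] N} (ht : IsColinear X Y t) (g : CoringHom 𝒞 𝒞) :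
    IsColinear (X.induced g) (Y.induced g) t := fun m => by
  change NTensor.map _ _ (Y.coact (t m)) = NTensor.map _ _ (NTensor.map _ _ (X.coact m))
  rw [ht, NTensor.map_map, NTensor.map_map]
  rfl

end Coring

/-! ### Duals, endomorphism rings -/

section Homs

variable {R T U M N : Type*} [Ring R] [Ring T] [Ring U] [AddCommGroup M] [Module R M]
  [AddCommGroup N] [Module R N]

/-- The right action `(f t)(m) = f (t m)` on `R`-linear maps. -/
instance (priority := 80) instModulePrecompRight [Module T M] [SMulCommClass R T M] :
    Module Tᵐᵒᵖ (M →ₗ[R] N) where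
  smul t f := { toFun := fun m => f (unop t • m)
                map_add' := fun m m' => by rw [smul_add, map_add]
                map_smul' := fun r m => by rw [← smul_comm r, map_smul]; rfl }
  one_smul f := LinearMap.ext fun m => congrArg f (one_smul T m)
  mul_smul s t f := LinearMap.ext fun m => congrArg f (mul_smul (unop t) (unop s) m)
  smul_zero _ := rfl
  smul_add _ _ _ := rfl
  add_smul s t f := LinearMap.ext fun m =>
    (congrArg f (add_smul (unop s) (unop t) m)).trans (map_add f _ _)
  zero_smul f := LinearMap.ext fun m => (congrArg f (zero_smul T m)).trans (map_zero f)

/-- The left action `(t f)(m) = f (m t)` on `R`-linear maps. -/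
instance (priority := 80) instModulePrecompLeft [Module Tᵐᵒᵖ M] [SMulCommClass Tᵐᵒᵖ R M] :
    Module T (M →ₗ[R] N) where
  smul t f := { toFun := fun m => f (op t • m)
                map_add' := fun m m' => by rw [smul_add, map_add]
                map_smul' := fun r m => by rw [smul_comm, map_smul]; rfl }
  one_smul f := LinearMap.ext fun m => congrArg f (one_smul Tᵐᵒᵖ m)
  mul_smul s t f := LinearMap.ext fun m => congrArg f (mul_smul (op t) (op s) m)
  smul_zero _ := rfl
  smul_add _ _ _ := rfl
  add_smul s t f := LinearMap.ext fun m =>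
    (congrArg f (add_smul (op s) (op t) m)).trans (map_add f _ _)
  zero_smul f := LinearMap.ext fun m => (congrArg f (zero_smul Tᵐᵒᵖ m)).trans (map_zero f)

instance (priority := 80) instSMulCommPrecompRight [Module T M] [SMulCommClass R T M] [Module U N]
    [SMulCommClass R U N] : SMulCommClass Tᵐᵒᵖ U (M →ₗ[R] N) :=
  ⟨fun _ _ _ => rfl⟩

instance (priority := 80) instSMulCommPrecompLeft [Module Tᵐᵒᵖ M] [SMulCommClass Tᵐᵒᵖ R M]
    [Module Uᵐᵒᵖ N] [SMulCommClass R Uᵐᵒᵖ N] : SMulCommClass Uᵐᵒᵖ T (M →ₗ[R] N) :=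
  ⟨fun _ _ _ => rfl⟩

end Homs

section Dual

variable (B : Type v) (A : Type u) (Sig : Type w) [Ring B] [Ring A] [AddCommGroup Sig] [Module B Sig]
  [Module Aᵐᵒᵖ Sig] [SMulCommClass Aᵐᵒᵖ B Sig]

/-- The right dual `Σ^* = Hom(Σ_A, A_A)`, an `(A, B)`-bimodule by `(a f b)(x) = a f(b x)`. -/
abbrev RightDual : Type _ := Sig →ₗ[Aᵐᵒᵖ] A

/-- The left dual `^*Σ = Hom(_BΣ, _BB)`, an `(A, B)`-bimodule by `(a f b)(x) = f(x a) b`. -/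
abbrev LeftDual : Type _ := Sig →ₗ[B] B

/-- The ring `S = End(Σ_A)`, a `B`-bimodule by `(b s b')(x) = b s(b' x)`. -/
abbrev EndRing : Type _ := Module.End Aᵐᵒᵖ Sig

/-- The evaluation `Σ ⊗_A ^*Σ → B`, `x ⊗ f ↦ f(x)`. -/
def leftEval : NTensor A Sig (LeftDual B Sig) →+ B :=
  NTensor.lift
    (AddMonoidHom.mk' (fun x => AddMonoidHom.mk' (fun f : LeftDual B Sig => f x) fun _ _ => rfl)
      fun x y => by ext f; exact map_add f x y)
    fun _ _ _ => rfl

/-- `_BΣ_A` is a separable bimodule: the evaluation `Σ ⊗_A ^*Σ → B` has a section which is a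
homomorphism of `B`-bimodules. -/
def IsSeparableBimodule : Prop :=
  ∃ σ : BimoduleHom B B B (NTensor A Sig (LeftDual B Sig)), ∀ b, leftEval B A Sig (σ b) = b

end Dual

/-! ### The comatrix coring -/

section ComatrixCoring

/-- A finite right dual basis `(e_i, e_i^*)` of `Σ_A`: `x = ∑ e_i e_i^*(x)` for all `x`. -/
structure DualBasis (A : Type u) (Sig : Type w) [Ring A] [AddCommGroup Sig] [Module Aᵐᵒᵖ Sig] where
  /-- The number of elements. -/
  card : ℕ
  /-- The elements `e_i`. -/
  vec : Fin card → Sig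
  /-- The functionals `e_i^*`. -/
  covec : Fin card → RightDual A Sig
  sum_eq : ∀ x, ∑ i, op (covec i x) • vec i = x

variable (B : Type v) (A : Type u) (Sig : Type w) [Ring B] [Ring A] [AddCommGroup Sig] [Module B Sig]
  [Module Aᵐᵒᵖ Sig] [SMulCommClass Aᵐᵒᵖ B Sig]

theorem DualBasis.nonempty [Module.Finite Aᵐᵒᵖ Sig] [Module.Projective Aᵐᵒᵖ Sig] :
    Nonempty (DualBasis A Sig) := by
  obtain ⟨n, f, g, -, -, hfg⟩ := Module.Finite.exists_comp_eq_id_of_projective Aᵐᵒᵖ Sig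
  refine ⟨⟨n, fun i => f (Pi.single i 1), fun i =>
    { toFun := fun x => unop (g x i)
      map_add' := fun x y => by rw [map_add]; rfl
      map_smul' := fun a x => by rw [map_smul]; rfl }, fun x => ?_⟩⟩
  have h : f (g x) = x := LinearMap.congr_fun hfg x
  conv_rhs => rw [← h, ← Finset.univ_sum_single (g x), map_sum]
  refine Finset.sum_congr rfl fun i _ => ?_
  change g x i • f (Pi.single i 1) = _
  rw [← map_smul, ← Pi.single_smul, smul_eq_mul, mul_one]

/-- A chosen dual basis of the finitely generated projective module `Σ_A`. -/
noncomputable def dualBasis [Module.Finite Aᵐᵒᵖ Sig] [Module.Projective Aᵐᵒᵖ Sig] :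
    DualBasis A Sig :=
  (DualBasis.nonempty A Sig).some

variable {A Sig}

theorem DualBasis.sum_covec (D : DualBasis A Sig) (f : RightDual A Sig) :
    ∑ i, f (D.vec i) • D.covec i = f := by
  ext x
  conv_rhs => rw [← D.sum_eq x, map_sum]
  simp

variable (A Sig)

/-- The `A`-bimodule `Σ^* ⊗_B Σ`. -/
abbrev ComatrixBimodule : Type _ := NTensor B (RightDual A Sig) Sig

variable {B A Sig} (D : DualBasis A Sig)

theorem DualBasis.sum_smul_tmul (b : B) :
    ∑ i, NTensor.tmul A (b • D.vec i) (D.covec i) =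
      ∑ i, NTensor.tmul A (D.vec i) (op b • D.covec i) := by
  have h₁ : ∀ i, NTensor.tmul A (b • D.vec i) (D.covec i) =
      ∑ j, NTensor.tmul A (D.vec j) (D.covec j (b • D.vec i) • D.covec i) := fun i => by
    conv_lhs => rw [← D.sum_eq (b • D.vec i), NTensor.sum_tmul]
    exact Finset.sum_congr rfl fun j _ => NTensor.smul_tmul A _ _ _
  rw [Finset.sum_congr rfl fun i _ => h₁ i, Finset.sum_comm]
  refine Finset.sum_congr rfl fun j _ => ?_
  rw [← NTensor.tmul_sum]
  exact congrArg _ (D.sum_covec (op b • D.covec j))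

variable (B) in
/-- The coaction `ρ(u) = ∑ e_i ⊗ e_i^* ⊗ u` as an additive map. -/
def coactHom : Sig →ₗ[Aᵐᵒᵖ] NTensor A Sig (ComatrixBimodule B A Sig) where
  toFun u := ∑ i, NTensor.tmul A (D.vec i) (NTensor.tmul B (D.covec i) u)
  map_add' u u' := by
    simp only [NTensor.tmul_add, Finset.sum_add_distrib]
  map_smul' a u := by
    rw [Finset.smul_sum]; rfl

theorem coactHom_apply (u : Sig) : coactHom B D u =
    ∑ i, NTensor.tmul A (D.vec i) (NTensor.tmul B (D.covec i) u) := rfl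

theorem coactHom_smul (b : B) (u : Sig) : coactHom B D (b • u) =
    ∑ i, NTensor.tmul A (b • D.vec i) (NTensor.tmul B (D.covec i) u) := by
  let r : RightDual A Sig →ₗ[A] ComatrixBimodule B A Sig :=
    { toFun := fun f => NTensor.tmul B f u
      map_add' := fun f f' => NTensor.add_tmul B f f' u
      map_smul' := fun a f => rfl }
  have h := congrArg (NTensor.map (LinearMap.id : Sig →ₗ[Aᵐᵒᵖ] Sig) r) (D.sum_smul_tmul b)
  rw [map_sum, map_sum] at h
  refine Eq.trans ?_ h.symm
  rw [coactHom_apply]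
  refine Finset.sum_congr rfl fun i _ => ?_
  exact congrArg (NTensor.tmul A (D.vec i)) (NTensor.smul_tmul B (D.covec i) b u).symm

/-- Left multiplication `Σ ⊗_A C → C ⊗_A C`, `x ⊗ c ↦ (f ⊗ x) ⊗ c`, by `f ∈ Σ^*`. -/
def insertLeft (f : RightDual A Sig) : NTensor A Sig (ComatrixBimodule B A Sig) →+
    NTensor A (ComatrixBimodule B A Sig) (ComatrixBimodule B A Sig) :=
  NTensor.map
    { toFun := fun x => NTensor.tmul B f x
      map_add' := NTensor.tmul_add B f
      map_smul' := fun _ _ => rfl } LinearMap.id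

variable (B) in
/-- The comultiplication `f ⊗ u ↦ ∑ (f ⊗ e_i) ⊗ (e_i^* ⊗ u)` as an additive map. -/
def comatrixComulHom : ComatrixBimodule B A Sig →+
    NTensor A (ComatrixBimodule B A Sig) (ComatrixBimodule B A Sig) :=
  NTensor.lift
    (AddMonoidHom.mk'
      (fun f => AddMonoidHom.mk'
        (fun u => ∑ i, NTensor.tmul A (NTensor.tmul B f (D.vec i)) (NTensor.tmul B (D.covec i) u))
        fun u u' => by simp only [NTensor.tmul_add, Finset.sum_add_distrib])
      fun f f' => by
        ext u
        simp only [AddMonoidHom.mk'_apply, AddMonoidHom.add_apply, NTensor.add_tmul,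
          Finset.sum_add_distrib])
    fun f b u => by
      have h := congrArg (insertLeft f) (coactHom_smul D b u)
      rw [coactHom_apply, map_sum, map_sum] at h
      refine Eq.trans ?_ h.symm
      change ∑ i, NTensor.tmul A (NTensor.tmul B (op b • f) (D.vec i)) (NTensor.tmul B (D.covec i) u)
        = _
      refine Finset.sum_congr rfl fun i _ => ?_
      exact congrArg (fun c => NTensor.tmul A c (NTensor.tmul B (D.covec i) u))
          (NTensor.smul_tmul B f b (D.vec i))

theorem comatrixComulHom_tmul (f : RightDual A Sig) (u : Sig) :
    comatrixComulHom B D (NTensor.tmul B f u) =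
      ∑ i, NTensor.tmul A (NTensor.tmul B f (D.vec i)) (NTensor.tmul B (D.covec i) u) := rfl

variable (B) in
/-- The comultiplication of the comatrix coring. -/
def comatrixComul : BimoduleHom A A (ComatrixBimodule B A Sig)
    (NTensor A (ComatrixBimodule B A Sig) (ComatrixBimodule B A Sig)) where
  toFun := comatrixComulHom B D
  map_add' := map_add _
  map_smul' a z := by
    induction z using NTensor.induction_on with
    | zero => simp only [smul_zero, map_zero]
    | add x y hx hy => simp only [smul_add, map_add, hx, hy]
    | tmul f u =>
      rw [comatrixComulHom_tmul, Finset.smul_sum]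
      exact comatrixComulHom_tmul D (a • f) u
  map_op_smul' a z := by
    change comatrixComulHom B D _ = _ • comatrixComulHom B D _
    induction z using NTensor.induction_on with
    | zero => simp only [smul_zero, map_zero]
    | add x y hx hy => simp only [smul_add, map_add, hx, hy]
    | tmul f u =>
      rw [comatrixComulHom_tmul, Finset.smul_sum]
      exact comatrixComulHom_tmul D f (op a • u)

variable (B A Sig) in
/-- The counit `f ⊗ u ↦ f(u)` of the comatrix coring. -/
def comatrixCounit : BimoduleHom A A (ComatrixBimodule B A Sig) A where
  toFun := NTensor.lift
    (AddMonoidHom.mk' (fun f : RightDual A Sig => f.toAddMonoidHom) fun _ _ => rfl)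
    fun _ _ _ => rfl
  map_add' := map_add _
  map_smul' a z := by
    induction z using NTensor.induction_on with
    | zero => simp only [smul_zero, map_zero]
    | add x y hx hy => simp only [smul_add, map_add, hx, hy]
    | tmul f u => rfl
  map_op_smul' a z := by
    change NTensor.lift _ _ _ = _ • NTensor.lift _ _ _
    induction z using NTensor.induction_on with
    | zero => simp only [smul_zero, map_zero]
    | add x y hx hy => simp only [smul_add, map_add, hx, hy]
    | tmul f u => exact map_smul f (op a) u

variable (B) in
/-- The comatrix coring `Σ^* ⊗_B Σ` computed with the dual basis `D`. -/
def comatrixCoringOf : Coring A (ComatrixBimodule B A Sig) where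
  comul := comatrixComul B D
  counit := comatrixCounit B A Sig
  coassoc c := by
    induction c using NTensor.induction_on with
    | zero => simp only [map_zero]
    | add x y hx hy => simp only [map_add, hx, hy]
    | tmul f u =>
      change NTensor.assoc (NTensor.map (comatrixComul B D).right LinearMap.id
        (comatrixComulHom B D (NTensor.tmul B f u))) =
          NTensor.map LinearMap.id (comatrixComul B D).left
            (comatrixComulHom B D (NTensor.tmul B f u))
      rw [comatrixComulHom_tmul]
      simp only [map_sum]
      have hl : ∀ i, NTensor.assoc (NTensor.map (comatrixComul B D).right LinearMap.id
          (NTensor.tmul A (NTensor.tmul B f (D.vec i)) (NTensor.tmul B (D.covec i) u))) =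
          ∑ j, NTensor.tmul A (NTensor.tmul B f (D.vec j))
            (NTensor.tmul A (NTensor.tmul B (D.covec j) (D.vec i))
              (NTensor.tmul B (D.covec i) u)) := fun i => by
        change NTensor.assoc (NTensor.tmul A (comatrixComulHom B D (NTensor.tmul B f (D.vec i)))
          (NTensor.tmul B (D.covec i) u)) = _
        rw [comatrixComulHom_tmul, NTensor.sum_tmul, map_sum]
        rfl
      have hr : ∀ i, NTensor.map LinearMap.id (comatrixComul B D).left
          (NTensor.tmul A (NTensor.tmul B f (D.vec i)) (NTensor.tmul B (D.covec i) u)) =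
          ∑ j, NTensor.tmul A (NTensor.tmul B f (D.vec i))
            (NTensor.tmul A (NTensor.tmul B (D.covec i) (D.vec j))
              (NTensor.tmul B (D.covec j) u)) := fun i => by
        rw [← NTensor.tmul_sum]
        rfl
      rw [Finset.sum_congr rfl fun i _ => hl i, Finset.sum_congr rfl fun i _ => hr i,
        Finset.sum_comm]
  counit_left c := by
    induction c using NTensor.induction_on with
    | zero => simp only [map_zero]
    | add x y hx hy => simp only [map_add, hx, hy]
    | tmul f u =>
      change NTensor.lid (NTensor.map (comatrixCounit B A Sig).right LinearMap.id
        (comatrixComulHom B D (NTensor.tmul B f u))) = NTensor.tmul B f u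
      rw [comatrixComulHom_tmul, map_sum, map_sum]
      conv_rhs => rw [← D.sum_covec f, NTensor.sum_tmul]
      rfl
  counit_right c := by
    induction c using NTensor.induction_on with
    | zero => simp only [map_zero]
    | add x y hx hy => simp only [map_add, hx, hy]
    | tmul f u =>
      change NTensor.rid (NTensor.map LinearMap.id (comatrixCounit B A Sig).left
        (comatrixComulHom B D (NTensor.tmul B f u))) = NTensor.tmul B f u
      rw [comatrixComulHom_tmul, map_sum, map_sum]
      conv_rhs => rw [← D.sum_eq u, NTensor.tmul_sum]
      rfl

variable (B) in
/-- The right comodule `Σ` over the comatrix coring, computed with the dual basis `D`. -/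
def sigmaComoduleOf : RightComodule (comatrixCoringOf B D) Sig where
  coact := coactHom B D
  coassoc u := by
    rw [coactHom_apply]
    simp only [map_sum]
    have hl : ∀ i, NTensor.assoc (NTensor.map (coactHom B D) LinearMap.id
        (NTensor.tmul A (D.vec i) (NTensor.tmul B (D.covec i) u))) =
        ∑ j, NTensor.tmul A (D.vec j) (NTensor.tmul A (NTensor.tmul B (D.covec j) (D.vec i))
            (NTensor.tmul B (D.covec i) u)) := fun i => by
      rw [NTensor.map_tmul, coactHom_apply, NTensor.sum_tmul, map_sum]
      rfl
    have hr : ∀ i, NTensor.map LinearMap.id (comatrixCoringOf B D).comul.left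
        (NTensor.tmul A (D.vec i) (NTensor.tmul B (D.covec i) u)) =
        ∑ j, NTensor.tmul A (D.vec i) (NTensor.tmul A (NTensor.tmul B (D.covec i) (D.vec j))
            (NTensor.tmul B (D.covec j) u)) := fun i => by
      rw [← NTensor.tmul_sum]
      rfl
    rw [Finset.sum_congr rfl fun i _ => hl i, Finset.sum_congr rfl fun i _ => hr i,
      Finset.sum_comm]
  counit u := by
    rw [coactHom_apply, map_sum, map_sum]
    exact D.sum_eq u

variable (B A Sig)
variable [Module.Finite Aᵐᵒᵖ Sig] [Module.Projective Aᵐᵒᵖ Sig]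

/-- The comatrix coring `Σ^* ⊗_B Σ`: `Δ(f ⊗ u) = ∑ (f ⊗ e_i) ⊗ (e_i^* ⊗ u)` and
`ε(f ⊗ u) = f(u)`. -/
noncomputable def comatrixCoring : Coring A (ComatrixBimodule B A Sig) :=
  comatrixCoringOf B (dualBasis A Sig)

/-- `Σ` as a right comodule over the comatrix coring: `ρ(u) = ∑ e_i ⊗ (e_i^* ⊗ u)`. -/
noncomputable def sigmaComodule : RightComodule (comatrixCoring B A Sig) Sig :=
  sigmaComoduleOf B (dualBasis A Sig)

end ComatrixCoring

/-! ### Sub-bimodules of `S = End(Σ_A)` -/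

/-- A `B`-sub-bimodule of a `B`-bimodule `M`. -/
structure SubBimodule (B M : Type*) [Ring B] [AddCommGroup M] [Module B M] [Module Bᵐᵒᵖ M] extends
    Submodule B M where
  op_smul_mem' : ∀ (b : B) {m : M}, m ∈ carrier → op b • m ∈ carrier

namespace SubBimodule

theorem ext {B M : Type*} [Ring B] [AddCommGroup M] [Module B M] [Module Bᵐᵒᵖ M]
    {I J : SubBimodule B M} (h : ∀ m, m ∈ I.toSubmodule ↔ m ∈ J.toSubmodule) : I = J := by
  cases I; cases J; congr; exact Submodule.ext h

variable {B : Type v} {A : Type u} {Sig : Type w} [Ring B] [Ring A] [AddCommGroup Sig]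
  [Module B Sig] [Module Aᵐᵒᵖ Sig] [SMulCommClass Aᵐᵒᵖ B Sig]

/-- The product `IJ`: all finite sums of products `x y` with `x ∈ I`, `y ∈ J`.  The set of these
products is stable under `B`, so its `B`-span is its additive span. -/
def mul (I J : SubBimodule B (EndRing A Sig)) : SubBimodule B (EndRing A Sig) where
  toSubmodule := Submodule.span B {z | ∃ x ∈ I.toSubmodule, ∃ y ∈ J.toSubmodule, z = x * y}
  op_smul_mem' b m hm := by
    change m ∈ Submodule.span B _ at hm
    change op b • m ∈ Submodule.span B _
    induction hm using Submodule.span_induction with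
    | mem z hz =>
      obtain ⟨x, hx, y, hy, rfl⟩ := hz
      exact Submodule.subset_span ⟨x, hx, op b • y, J.op_smul_mem' b hy, rfl⟩
    | zero => rw [smul_zero]; exact Submodule.zero_mem _
    | add y z _ _ hy hz => rw [smul_add]; exact Submodule.add_mem _ hy hz
    | smul c z _ hz => rw [smul_comm]; exact Submodule.smul_mem _ c hz

/-- The image `{b • 1 | b ∈ B}` of `B` in `S`. -/
def one : SubBimodule B (EndRing A Sig) where
  toSubmodule := Submodule.span B {1}
  op_smul_mem' b m hm := by
    obtain ⟨c, rfl⟩ := Submodule.mem_span_singleton.1 hm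
    refine Submodule.mem_span_singleton.2 ⟨c * b, ?_⟩
    ext x
    exact mul_smul c b x

theorem mul_mem_mul {I J : SubBimodule B (EndRing A Sig)} {x y : EndRing A Sig}
    (hx : x ∈ I.toSubmodule) (hy : y ∈ J.toSubmodule) : x * y ∈ (mul I J).toSubmodule :=
  Submodule.subset_span ⟨x, hx, y, hy, rfl⟩

theorem mul_le {I J : SubBimodule B (EndRing A Sig)} {K : Submodule B (EndRing A Sig)}
    (h : ∀ x ∈ I.toSubmodule, ∀ y ∈ J.toSubmodule, x * y ∈ K) : (mul I J).toSubmodule ≤ K :=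
  Submodule.span_le.2 <| by rintro _ ⟨x, hx, y, hy, rfl⟩; exact h x hx y hy

theorem mem_one (b : B) : b • (1 : EndRing A Sig) ∈ (one (B := B) (A := A) (Sig := Sig)).toSubmodule :=
  Submodule.mem_span_singleton.2 ⟨b, rfl⟩

theorem mul_smul_eq (b : B) (s t : EndRing A Sig) : s * (b • t) = (op b • s) * t := rfl

theorem mul_assoc (I J K : SubBimodule B (EndRing A Sig)) :
    mul (mul I J) K = mul I (mul J K) := by
  have h₁ : (mul (mul I J) K).toSubmodule ≤ (mul I (mul J K)).toSubmodule := by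
    refine mul_le fun z hz w hw => ?_
    induction hz using Submodule.span_induction with
    | mem z hz =>
      obtain ⟨x, hx, y, hy, rfl⟩ := hz
      rw [_root_.mul_assoc]
      exact mul_mem_mul hx (mul_mem_mul hy hw)
    | zero => rw [zero_mul]; exact Submodule.zero_mem _
    | add y z _ _ hy hz => rw [add_mul]; exact Submodule.add_mem _ hy hz
    | smul c z _ hz => exact Submodule.smul_mem _ c hz
  have h₂ : (mul I (mul J K)).toSubmodule ≤ (mul (mul I J) K).toSubmodule := by
    refine mul_le fun x hx z hz => ?_
    induction hz using Submodule.span_induction generalizing x with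
    | mem z hz =>
      obtain ⟨y, hy, w, hw, rfl⟩ := hz
      rw [← _root_.mul_assoc]
      exact mul_mem_mul (mul_mem_mul hx hy) hw
    | zero => rw [mul_zero]; exact Submodule.zero_mem _
    | add y z _ _ hy hz => rw [mul_add]; exact Submodule.add_mem _ (hy x hx) (hz x hx)
    | smul c z _ hz => exact hz (op c • x) (I.op_smul_mem' c hx)
  exact ext fun m => ⟨fun h => h₁ h, fun h => h₂ h⟩

theorem one_mul (I : SubBimodule B (EndRing A Sig)) : mul one I = I := by
  have h : (mul one I).toSubmodule ≤ I.toSubmodule := by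
    refine mul_le fun x hx y hy => ?_
    obtain ⟨c, rfl⟩ := Submodule.mem_span_singleton.1 hx
    exact I.smul_mem c hy
  refine ext fun m => ⟨fun hm => h hm, fun hm => ?_⟩
  have := mul_mem_mul (mem_one (1 : B)) hm
  rwa [one_smul, _root_.one_mul] at this

theorem mul_one (I : SubBimodule B (EndRing A Sig)) : mul I one = I := by
  have h : (mul I one).toSubmodule ≤ I.toSubmodule := by
    refine mul_le fun x hx y hy => ?_
    obtain ⟨c, rfl⟩ := Submodule.mem_span_singleton.1 hy
    exact I.op_smul_mem' c hx
  refine ext fun m => ⟨fun hm => h hm, fun hm => ?_⟩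
  have := mul_mem_mul hm (mem_one (1 : B))
  rwa [one_smul, _root_.mul_one] at this

/-- The monoid of all `B`-sub-bimodules of `S`. -/
instance : Monoid (SubBimodule B (EndRing A Sig)) where
  mul := mul
  one := one
  mul_assoc := mul_assoc
  one_mul := one_mul
  mul_one := mul_one

/-- The multiplication map `S ⊗_B I → S`, `s ⊗ x ↦ s x`. -/
def mulMap (I : SubBimodule B (EndRing A Sig)) :
    NTensor B (EndRing A Sig) I.toSubmodule →+ EndRing A Sig :=
  NTensor.lift
    (AddMonoidHom.mk' (fun s => AddMonoidHom.mk' (fun x => s * (x : EndRing A Sig))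
        fun x y => mul_add s _ _)
      fun s t => by ext1 x; exact add_mul s t _)
    fun _ _ _ => rfl

@[simp] theorem mulMap_tmul (I : SubBimodule B (EndRing A Sig)) (s : EndRing A Sig)
    (x : I.toSubmodule) : mulMap I (NTensor.tmul B s x) = s * (x : EndRing A Sig) := rfl

theorem mulMap_one_bijective :
    Function.Bijective (mulMap (1 : SubBimodule B (EndRing A Sig))) := by
  let e : (1 : SubBimodule B (EndRing A Sig)).toSubmodule :=
    ⟨1, Submodule.mem_span_singleton_self 1⟩
  have key : ∀ z, z = NTensor.tmul B (mulMap (1 : SubBimodule B (EndRing A Sig)) z) e := by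
    intro z
    induction z using NTensor.induction_on with
    | zero => rw [map_zero, NTensor.zero_tmul]
    | add x y hx hy => rw [map_add, NTensor.add_tmul, ← hx, ← hy]
    | tmul s x =>
      obtain ⟨x, hx⟩ := x
      obtain ⟨c, rfl⟩ := Submodule.mem_span_singleton.1 hx
      exact (NTensor.smul_tmul B s c e).symm
  refine ⟨fun z z' h => ?_, fun s => ⟨NTensor.tmul B s e, _root_.mul_one s⟩⟩
  rw [key z, key z', h]

theorem mulMap_mul_bijective {I J : SubBimodule B (EndRing A Sig)}
    (hI : Function.Bijective (mulMap I)) (hJ : Function.Bijective (mulMap J)) :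
    Function.Bijective (mulMap (I * J)) := by
  let eI : NTensor B (EndRing A Sig) I.toSubmodule ≃+ EndRing A Sig :=
    AddEquiv.ofBijective (mulMap I) hI
  let r : J.toSubmodule → I.toSubmodule →ₗ[B] (I * J).toSubmodule := fun y =>
    { toFun := fun x => ⟨x * y, mul_mem_mul x.2 y.2⟩
      map_add' := fun x x' => Subtype.ext (add_mul _ _ _)
      map_smul' := fun b x => rfl }
  let c : B → I.toSubmodule →ₗ[B] I.toSubmodule := fun b =>
    { toFun := fun x => ⟨op b • (x : EndRing A Sig), I.op_smul_mem' b x.2⟩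
      map_add' := fun x x' => Subtype.ext (smul_add _ _ _)
      map_smul' := fun b x => rfl }
  let γ : J.toSubmodule → NTensor B (EndRing A Sig) I.toSubmodule →+
    NTensor B (EndRing A Sig) (I * J).toSubmodule := fun y => NTensor.map LinearMap.id (r y)
  have hγ_add : ∀ y y' z, γ (y + y') z = γ y z + γ y' z := by
    intro y y' z
    induction z using NTensor.induction_on with
    | zero => simp only [map_zero, add_zero]
    | add z z' hz hz' => simp only [map_add, hz, hz']; abel
    | tmul s x =>
      refine Eq.trans ?_ (NTensor.tmul_add B s (r y x) (r y' x))
      exact congrArg (NTensor.tmul B s) (Subtype.ext (mul_add _ _ _))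
  have hc : ∀ b t, eI.symm (op b • t) = NTensor.map LinearMap.id (c b) (eI.symm t) := by
    intro b t
    obtain ⟨z, rfl⟩ := eI.surjective t
    rw [eI.symm_apply_apply, eI.symm_apply_eq]
    induction z using NTensor.induction_on with
    | zero => simp only [map_zero, smul_zero]
    | add z z' hz hz' => simp only [map_add, smul_add, hz, hz']
    | tmul s x => rfl
  let β : NTensor B (EndRing A Sig) J.toSubmodule →+
      NTensor B (EndRing A Sig) (I * J).toSubmodule :=
    NTensor.lift
      (AddMonoidHom.mk' (fun t => AddMonoidHom.mk' (fun y => γ y (eI.symm t))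
          fun y y' => hγ_add y y' _)
        fun t t' => by
          ext1 y
          exact (congrArg (γ y) (map_add eI.symm t t')).trans (map_add (γ y) _ _))
      fun t b y => by
        change γ y (eI.symm (op b • t)) = γ (b • y) (eI.symm t)
        rw [hc]
        exact NTensor.map_map _ _ _ _ _
  have hβ : ∀ s (x : I.toSubmodule) (y : J.toSubmodule),
      β (NTensor.tmul B (s * (x : EndRing A Sig)) y) = NTensor.tmul B s (r y x) := by
    intro s x y
    change γ y (eI.symm (eI (NTensor.tmul B s x))) = _
    rw [eI.symm_apply_apply]
    rfl
  have hcomp : ∀ z, mulMap (I * J) (β z) = mulMap J z := by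
    intro z
    induction z using NTensor.induction_on with
    | zero => simp only [map_zero]
    | add z z' hz hz' => simp only [map_add, hz, hz']
    | tmul t y =>
      obtain ⟨w, rfl⟩ := eI.surjective t
      induction w using NTensor.induction_on with
      | zero => simp only [map_zero, NTensor.zero_tmul]
      | add z z' hz hz' => simp only [map_add, NTensor.add_tmul, hz, hz']
      | tmul s x =>
        change mulMap (I * J) (β (NTensor.tmul B (s * (x : EndRing A Sig)) y)) = _
        rw [hβ]
        rfl
  have hsurj : Function.Surjective β := by
    intro z
    induction z using NTensor.induction_on with
    | zero => exact ⟨0, map_zero β⟩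
    | add z z' hz hz' =>
      obtain ⟨a, rfl⟩ := hz
      obtain ⟨a', rfl⟩ := hz'
      exact ⟨a + a', map_add β a a'⟩
    | tmul s p =>
      obtain ⟨p, hp⟩ := p
      change p ∈ Submodule.span B _ at hp
      induction hp using Submodule.span_induction generalizing s with
      | mem p hp =>
        obtain ⟨x, hx, y, hy, rfl⟩ := hp
        exact ⟨_, hβ s ⟨x, hx⟩ ⟨y, hy⟩⟩
      | zero => exact ⟨0, (map_zero β).trans (NTensor.tmul_zero B s).symm⟩
      | add p q hp hq ihp ihq =>
        obtain ⟨a, ha⟩ := ihp s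
        obtain ⟨a', ha'⟩ := ihq s
        exact ⟨a + a', by rw [map_add, ha, ha', ← NTensor.tmul_add]; rfl⟩
      | smul b p hp ihp =>
        obtain ⟨a, ha⟩ := ihp (op b • s)
        exact ⟨a, ha.trans (NTensor.smul_tmul B s b _)⟩
  constructor
  · intro z z' h
    obtain ⟨a, rfl⟩ := hsurj z
    obtain ⟨a', rfl⟩ := hsurj z'
    rw [hcomp, hcomp] at h
    rw [hJ.1 h]
  · intro s
    obtain ⟨a, ha⟩ := hJ.2 s
    exact ⟨β a, (hcomp a).trans ha⟩

end SubBimodule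

section Main

variable (B : Type v) (A : Type u) (Sig : Type w) [Ring B] [Ring A] [AddCommGroup Sig] [Module B Sig]
  [Module Aᵐᵒᵖ Sig] [SMulCommClass Aᵐᵒᵖ B Sig]

/-- The monoid of the `B`-sub-bimodules `I` of `S` for which the multiplication map
`S ⊗_B I → S` is bijective. -/
def leftSubBimodules : Submonoid (SubBimodule B (EndRing A Sig)) where
  carrier := {I | Function.Bijective I.mulMap}
  one_mem' := SubBimodule.mulMap_one_bijective
  mul_mem' := SubBimodule.mulMap_mul_bijective

variable {B A Sig} in
/-- The multiplication isomorphism `S ⊗_B I ≅ S`. -/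
noncomputable def mulEquiv (I : leftSubBimodules B A Sig) :
    NTensor B (EndRing A Sig) I.1.toSubmodule ≃+ EndRing A Sig :=
  AddEquiv.ofBijective I.1.mulMap I.2

variable [Module.Finite Aᵐᵒᵖ Sig] [Module.Projective Aᵐᵒᵖ Sig]

variable {Sig} in
theorem isColinear_smul_one (b : B) :
    IsColinear (sigmaComodule B A Sig) (sigmaComodule B A Sig) (b • (1 : EndRing A Sig)) :=
  fun u => by
    change coactHom B (dualBasis A Sig) (b • u) =
      NTensor.map _ _ (coactHom B (dualBasis A Sig) u)
    rw [coactHom_smul, coactHom_apply, map_sum]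
    rfl

variable {A Sig} in
/-- `Hom_C(Σ_g, Σ)`, as a `B`-sub-bimodule of `S = End(Σ_A)`. -/
def colinearHoms (g : CoringHom (comatrixCoring B A Sig) (comatrixCoring B A Sig)) :
    SubBimodule B (EndRing A Sig) where
  carrier := {t | IsColinear ((sigmaComodule B A Sig).induced g) (sigmaComodule B A Sig) t}
  zero_mem' u := by
    change (sigmaComodule B A Sig).coact 0 = _
    rw [map_zero]
    generalize ((sigmaComodule B A Sig).induced g).coact u = z
    induction z using NTensor.induction_on with
    | zero => rw [map_zero]
    | add x y hx hy => rw [map_add, ← hx, ← hy, add_zero]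
    | tmul x c => exact (NTensor.zero_tmul A c).symm
  add_mem' {s t} hs ht u := by
    change (sigmaComodule B A Sig).coact (s u + t u) = _
    rw [map_add, hs, ht]
    generalize ((sigmaComodule B A Sig).induced g).coact u = z
    induction z using NTensor.induction_on with
    | zero => simp only [map_zero, add_zero]
    | add x y hx hy => simp only [map_add, ← hx, ← hy]; abel
    | tmul x c => exact (NTensor.add_tmul A (s x) (t x) c).symm
  smul_mem' b t ht := by
    have h := IsColinear.comp (isColinear_smul_one (Sig := Sig) B A b) ht
    exact h
  op_smul_mem' b t ht := by
    have ht' : IsColinear ((sigmaComodule B A Sig).induced g) (sigmaComodule B A Sig) t := ht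
    have h := ht'.comp ((isColinear_smul_one (Sig := Sig) B A b).induced g)
    exact h

end Main

end Comatrix

namespace Comatrix

open MulOpposite

universe u v w

/-! Since Σ_A has a finite dual basis, every A-bimodule endomorphism g of Σ^* ⊗_B Σ has the form g(f
⊗ u) = f p u for some p in S ⊗_B S, namely p = ∑ e_i g(e_i^* ⊗ e_j) e_j^*
(`DualBasis.sandwich_tensorOf`). Under this dictionary, g preserves the counit iff p multiplies to 1
(`Represents.counit_iff`). It preserves the comultiplication iff ∑ s_i ⊗ 1 ⊗ t_i = ∑ s_i ⊗ t_i p for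
p = ∑ s_i ⊗ t_i (`Represents.comul_iff`). So p is a grouplike element of the Sweedler coring S ⊗_B
S. An endomorphism t of Σ_A is colinear from Σ_g to Σ iff 1 ⊗ t = t p (`Represents.colinear_iff`).
Thus Hom_C(Σ_g, Σ) is the equalizer I of the left B-linear maps t ↦ 1 ⊗ t and t ↦ t p.

After applying S ⊗_B -, this pair of maps becomes easy: an element z of S ⊗_B S that it equalizes is
m(z) p, with m the multiplication (`eq_lactHom_mulS`). Hence, once S ⊗_B I → S ⊗_B S is injective
and p lies in its image, multiplication S ⊗_B I → S is bijective
(`IsCoinvariants.mulMap_bijective`). In case (a), S is a direct summand of a finite power of Σ^* as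
a right B-module, hence flat, and S ⊗_B - preserves the equalizer. In case (b), the separability
section yields a B-bimodule retraction π of B → S, and t ↦ (π ⊗ S)(t p) is a left B-linear
projection of S onto I.

Conversely, let I have bijective multiplication and let p_I be the image of m^{-1}(1) in S ⊗_B S.
Uniqueness of preimages under m makes p_I central for B and grouplike, so it defines a coring
endomorphism. Its equalizer J contains I. Faithful flatness gives J/I = 0, while in case (b)
applying π to 1 ⊗ t = t p_I puts t back in I. In the other direction the p attached to g equals p_I
for its equalizer I (`unitTensor_eq`), so the constructions are mutually inverse.

Multiplicativity is checked on Γ^l, where it is explicit: if m^{-1}(1) is ∑ s_l ⊗ x_l for I and ∑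
t_k ⊗ y_k for J, it is ∑ t_k s_l ⊗ x_l y_k for IJ (`coringHomOf_mul`). -/

theorem NTensor.exists_eq_sum {R M N : Type*} [Ring R] [AddCommGroup M] [Module Rᵐᵒᵖ M]
    [AddCommGroup N] [Module R N] (z : NTensor R M N) :
    ∃ (n : ℕ) (m : Fin n → M) (x : Fin n → N), z = ∑ k, NTensor.tmul R (m k) (x k) := by
  induction z using NTensor.induction_on with
  | zero => exact ⟨0, Fin.elim0, Fin.elim0, by simp⟩
  | tmul m n => exact ⟨1, fun _ => m, fun _ => n, by simp⟩
  | add y z hy hz =>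
    obtain ⟨k, m, x, rfl⟩ := hy
    obtain ⟨l, m', x', rfl⟩ := hz
    refine ⟨k + l, Fin.append m m', Fin.append x x', ?_⟩
    simp [Fin.sum_univ_add]

/-! ### Elementary maps between Σ, Σ^* and S -/

section Postcomp

variable {R M N P : Type*} (T : Type*) [Ring R] [Ring T] [AddCommGroup M] [Module R M]
  [Module T M] [SMulCommClass R T M] [AddCommGroup N] [Module R N] [AddCommGroup P] [Module R P]

/-- Composition `s ↦ φ ∘ s`, as a map of right `T`-modules. -/
def postcomp (φ : N →ₗ[R] P) : (M →ₗ[R] N) →ₗ[Tᵐᵒᵖ] (M →ₗ[R] P) where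
  toFun s := φ ∘ₗ s
  map_add' s t := LinearMap.comp_add s t φ
  map_smul' _ _ := rfl

@[simp] theorem postcomp_apply (φ : N →ₗ[R] P) (s : M →ₗ[R] N) : postcomp T φ s = φ ∘ₗ s := rfl

end Postcomp

variable {B : Type v} {A : Type u} {Sig : Type w} [Ring B] [Ring A] [AddCommGroup Sig]
  [Module B Sig] [Module Aᵐᵒᵖ Sig] [SMulCommClass Aᵐᵒᵖ B Sig]

/-- The map `a ↦ x a`. -/
def ray {M : Type*} [AddCommGroup M] [Module Aᵐᵒᵖ M] (x : M) : A →ₗ[Aᵐᵒᵖ] M where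
  toFun a := op a • x
  map_add' a b := by rw [op_add, add_smul]
  map_smul' a b := by
    change op (b * unop a) • x = a • op b • x
    rw [op_mul, mul_smul, op_unop]

@[simp] theorem ray_apply {M : Type*} [AddCommGroup M] [Module Aᵐᵒᵖ M] (x : M) (a : A) :
    ray x a = op a • x := rfl

variable (B) in
/-- Evaluation `t ↦ t u`. -/
def evalAt (u : Sig) : EndRing A Sig →ₗ[B] Sig where
  toFun t := t u
  map_add' _ _ := rfl
  map_smul' _ _ := rfl

@[simp] theorem evalAt_apply (u : Sig) (t : EndRing A Sig) : evalAt B u t = t u := rfl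

variable (B) in
/-- The map `u ↦ (y ↦ u h(y))`. -/
def outer (h : RightDual A Sig) : Sig →ₗ[B] EndRing A Sig where
  toFun u := ray u ∘ₗ h
  map_add' u v := by ext y; exact smul_add _ _ _
  map_smul' b u := by ext y; exact smul_comm _ _ _

@[simp] theorem outer_apply (h : RightDual A Sig) (u : Sig) : outer B h u = ray u ∘ₗ h := rfl

theorem DualBasis.sum_outer (D : DualBasis A Sig) (t : EndRing A Sig) :
    ∑ j, outer B (D.covec j) (t (D.vec j)) = t := by
  ext x
  conv_rhs => rw [← D.sum_eq x, map_sum]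
  simp

/-! ### The left S-action on S ⊗_B N -/

section LeftAction

variable {N N' : Type*} [AddCommGroup N] [Module B N] [AddCommGroup N'] [Module B N']

/-- `t ↦ t w` for `w ∈ S ⊗_B N`. -/
def lactHom (w : NTensor B (EndRing A Sig) N) :
    EndRing A Sig →ₗ[B] NTensor B (EndRing A Sig) N where
  toFun t := NTensor.map (postcomp B t) LinearMap.id w
  map_add' s t := by
    induction w using NTensor.induction_on with
    | zero => simp only [map_zero, add_zero]
    | tmul m n => simp only [NTensor.map_tmul, ← NTensor.add_tmul]; rfl
    | add x y hx hy => simp only [map_add, hx, hy]; abel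
  map_smul' b t := by
    induction w using NTensor.induction_on with
    | zero => simp only [map_zero, smul_zero]
    | tmul m n => rfl
    | add x y hx hy => simp only [map_add, smul_add, hx, hy]

@[simp] theorem lactHom_tmul (s t : EndRing A Sig) (n : N) :
    lactHom (NTensor.tmul B s n) t = NTensor.tmul B (t * s) n := rfl

theorem lactHom_apply (w : NTensor B (EndRing A Sig) N) (t : EndRing A Sig) :
    lactHom w t = NTensor.map (postcomp B t) LinearMap.id w := rfl

theorem lactHom_add (w w' : NTensor B (EndRing A Sig) N) :
    lactHom (w + w') = lactHom w + lactHom w' :=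
  LinearMap.ext fun t => map_add (NTensor.map (postcomp B t) LinearMap.id) w w'

theorem lactHom_zero : lactHom (0 : NTensor B (EndRing A Sig) N) = 0 :=
  LinearMap.ext fun t => map_zero (NTensor.map (postcomp B t) LinearMap.id)

@[simp] theorem lactHom_one (w : NTensor B (EndRing A Sig) N) : lactHom w 1 = w :=
  NTensor.map_id w

theorem map_lactHom (φ : N →ₗ[B] N') (w : NTensor B (EndRing A Sig) N) (t : EndRing A Sig) :
    NTensor.map LinearMap.id φ (lactHom w t) = lactHom (NTensor.map LinearMap.id φ w) t := by
  rw [lactHom_apply, lactHom_apply, NTensor.map_map, NTensor.map_map]; rfl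

variable (B A Sig N) in
/-- The map `n ↦ 1 ⊗ n`. -/
def oneTmul : N →ₗ[B] NTensor B (EndRing A Sig) N where
  toFun n := NTensor.tmul B 1 n
  map_add' := NTensor.tmul_add B 1
  map_smul' b n := by
    rw [← NTensor.smul_tmul]; rfl

@[simp] theorem oneTmul_apply (n : N) :
    oneTmul B A Sig N n = NTensor.tmul B (1 : EndRing A Sig) n := rfl

/-- The multiplication `S ⊗_B (S ⊗_B N) → S ⊗_B N` in the first two factors. -/
def lmulHom : NTensor B (EndRing A Sig) (NTensor B (EndRing A Sig) N) →+
    NTensor B (EndRing A Sig) N :=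
  NTensor.lift
    (AddMonoidHom.mk' (fun s => NTensor.map (postcomp B s) LinearMap.id) fun s t => by
      ext w; exact map_add (lactHom w) s t)
    fun s b w => by
      change lactHom w (op b • s) = lactHom (b • w) s
      induction w using NTensor.induction_on with
      | zero => simp only [smul_zero, lactHom_zero, LinearMap.zero_apply]
      | tmul m n => rfl
      | add x y hx hy => simp only [smul_add, lactHom_add, LinearMap.add_apply, hx, hy]

@[simp] theorem lmulHom_tmul (s : EndRing A Sig) (w : NTensor B (EndRing A Sig) N) :
    lmulHom (NTensor.tmul B s w) = lactHom w s := rfl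

end LeftAction

/-! ### Multiplication on S ⊗_B S and coinvariants of a tensor -/

variable (B A Sig) in
/-- The multiplication `S ⊗_B S → S`. -/
def mulS : NTensor B (EndRing A Sig) (EndRing A Sig) →+ EndRing A Sig :=
  NTensor.lift AddMonoidHom.mul fun _ _ _ => rfl

@[simp] theorem mulS_tmul (s t : EndRing A Sig) : mulS B A Sig (NTensor.tmul B s t) = s * t := rfl

theorem mulS_map_subtype (I : SubBimodule B (EndRing A Sig))
    (z : NTensor B (EndRing A Sig) I.toSubmodule) :
    mulS B A Sig (NTensor.map LinearMap.id I.toSubmodule.subtype z) = I.mulMap z := by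
  induction z using NTensor.induction_on with
  | zero => simp only [map_zero]
  | tmul m n => rfl
  | add x y hx hy => simp only [map_add, hx, hy]

theorem mulMap_lactHom (I : SubBimodule B (EndRing A Sig))
    (z : NTensor B (EndRing A Sig) I.toSubmodule) (s : EndRing A Sig) :
    I.mulMap (lactHom z s) = s * I.mulMap z := by
  induction z using NTensor.induction_on with
  | zero => simp only [lactHom_zero, LinearMap.zero_apply, map_zero, mul_zero]
  | tmul m n => exact mul_assoc s m (n : EndRing A Sig)
  | add x y hx hy => simp only [lactHom_add, LinearMap.add_apply, map_add, mul_add, hx, hy]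

/-- Multiplying the first two factors of S ⊗_B S ⊗_B S turns ∑ s ⊗ 1 ⊗ t back into z and turns ∑ s ⊗
t p into m(z) p. This is the contraction that splits the fork after tensoring with S. -/
theorem eq_lactHom_mulS {p z : NTensor B (EndRing A Sig) (EndRing A Sig)}
    (h : NTensor.map LinearMap.id (oneTmul B A Sig _) z = NTensor.map LinearMap.id (lactHom p) z) :
    z = lactHom p (mulS B A Sig z) := by
  have h₁ : ∀ y, lmulHom (NTensor.map LinearMap.id (oneTmul B A Sig (EndRing A Sig)) y) = y := by
    intro y
    induction y using NTensor.induction_on with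
    | zero => simp only [map_zero]
    | tmul m n => simp
    | add x y hx hy => simp only [map_add, hx, hy]
  have h₂ : ∀ y, lmulHom (NTensor.map LinearMap.id (lactHom p) y) =
      lactHom p (mulS B A Sig y) := by
    intro y
    induction y using NTensor.induction_on with
    | zero => simp only [map_zero]
    | tmul m n =>
      simp only [NTensor.map_tmul, LinearMap.id_apply, lmulHom_tmul, mulS_tmul]
      rw [lactHom_apply, lactHom_apply, NTensor.map_map]; rfl
    | add x y hx hy => simp only [map_add, hx, hy]
  rw [← h₂, ← h, h₁]

/-- The subgroup `{t | 1 ⊗ t = t p}` is `I`. -/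
def IsCoinvariants (I : SubBimodule B (EndRing A Sig))
    (p : NTensor B (EndRing A Sig) (EndRing A Sig)) : Prop :=
  ∀ t, t ∈ I.toSubmodule ↔ NTensor.tmul B 1 t = lactHom p t

/-- The image of z in S ⊗_B S has its second leg in I, where x satisfies 1 ⊗ x = x p, so the
hypothesis of `eq_lactHom_mulS` holds. -/
theorem IsCoinvariants.map_eq {I : SubBimodule B (EndRing A Sig)}
    {p : NTensor B (EndRing A Sig) (EndRing A Sig)} (h : IsCoinvariants I p)
    (z : NTensor B (EndRing A Sig) I.toSubmodule) :
    NTensor.map LinearMap.id I.toSubmodule.subtype z = lactHom p (I.mulMap z) := by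
  rw [← mulS_map_subtype]
  refine eq_lactHom_mulS ?_
  rw [NTensor.map_map, NTensor.map_map]
  congr 2
  ext1 x
  exact (h x).1 x.2

/-- The common core of cases (a) and (b). By `IsCoinvariants.map_eq` the inclusion into S ⊗_B S
factors through multiplication, so injectivity of the former gives that of the latter. A preimage q
of p multiplies to 1, so s q multiplies to s. -/
theorem IsCoinvariants.mulMap_bijective {I : SubBimodule B (EndRing A Sig)}
    {p : NTensor B (EndRing A Sig) (EndRing A Sig)} (h : IsCoinvariants I p)
    (hp : mulS B A Sig p = 1)
    (hinj : Function.Injective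
      (NTensor.map (LinearMap.id : EndRing A Sig →ₗ[Bᵐᵒᵖ] _) I.toSubmodule.subtype))
    (hmem : ∃ q, NTensor.map (LinearMap.id : EndRing A Sig →ₗ[Bᵐᵒᵖ] _) I.toSubmodule.subtype q = p) :
    Function.Bijective I.mulMap := by
  refine ⟨fun z z' hz => hinj ?_, fun s => ?_⟩
  · rw [h.map_eq, h.map_eq, hz]
  · obtain ⟨q, hq⟩ := hmem
    refine ⟨lactHom q s, ?_⟩
    rw [mulMap_lactHom, ← mulS_map_subtype, hq, hp, mul_one]

/-! ### Right exactness and flatness of the tensor product -/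

section RightExact

variable {R M N N' : Type*} [Ring R] [AddCommGroup M] [Module Rᵐᵒᵖ M]
  [AddCommGroup N] [Module R N] [AddCommGroup N'] [Module R N']

theorem NTensor.map_zero_right {M' : Type*} [AddCommGroup M'] [Module Rᵐᵒᵖ M']
    (f : M →ₗ[Rᵐᵒᵖ] M') (z : NTensor R M N) :
    NTensor.map f (0 : N →ₗ[R] N') z = 0 := by
  induction z using NTensor.induction_on with
  | zero => simp only [map_zero]
  | tmul m n => simp
  | add x y hx hy => simp only [map_add, hx, hy, add_zero]

theorem NTensor.map_sub_right {M' : Type*} [AddCommGroup M'] [Module Rᵐᵒᵖ M']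
    (f : M →ₗ[Rᵐᵒᵖ] M') (g h : N →ₗ[R] N') (z : NTensor R M N) :
    NTensor.map f (g - h) z = NTensor.map f g z - NTensor.map f h z := by
  induction z using NTensor.induction_on with
  | zero => simp only [map_zero, sub_zero]
  | tmul m n =>
    simp only [NTensor.map_tmul, LinearMap.sub_apply]
    exact map_sub (NTensor.mk R (f m)) _ _
  | add x y hx hy => simp only [map_add, hx, hy]; abel

/-- Right exactness of the tensor product. -/
theorem NTensor.exists_map_subtype_of_map_mkQ (K : Submodule R N) (z : NTensor R M N)
    (hz : NTensor.map (LinearMap.id : M →ₗ[Rᵐᵒᵖ] M) K.mkQ z = 0) :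
    ∃ y, NTensor.map (LinearMap.id : M →ₗ[Rᵐᵒᵖ] M) K.subtype y = z := by
  let H := (NTensor.map (LinearMap.id : M →ₗ[Rᵐᵒᵖ] M) K.subtype).range
  let q : NTensor R M N →+ NTensor R M N ⧸ H := QuotientAddGroup.mk' H
  have hq : ∀ m, K.toAddSubgroup ≤ (q.comp (NTensor.mk R m)).ker := fun m n hn =>
    (QuotientAddGroup.eq_zero_iff _).2 ⟨NTensor.tmul R m ⟨n, hn⟩, rfl⟩
  -- The map M ⊗ N/K → coker(M ⊗ K → M ⊗ N), m ⊗ [n] ↦ [m ⊗ n], sends the image of z to the class of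
  -- z. If that image vanishes, then z comes from M ⊗ K.
  let β : NTensor R M (N ⧸ K) →+ NTensor R M N ⧸ H :=
    NTensor.lift
      (AddMonoidHom.mk' (fun m => QuotientAddGroup.lift K.toAddSubgroup _ (hq m)) fun m m' => by
        refine QuotientAddGroup.addMonoidHom_ext _ ?_
        ext n
        exact (congrArg q (NTensor.add_tmul R m m' n)).trans (map_add q _ _))
      fun m r n => by
        obtain ⟨n, rfl⟩ := K.mkQ_surjective n
        exact congrArg q (NTensor.smul_tmul R m r n)
  have hβ : ∀ y, β (NTensor.map (LinearMap.id : M →ₗ[Rᵐᵒᵖ] M) K.mkQ y) = q y := by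
    intro y
    induction y using NTensor.induction_on with
    | zero => simp only [map_zero]
    | tmul m n => rfl
    | add x y hx hy => simp only [map_add, hx, hy]
  have := hβ z
  rw [hz, map_zero] at this
  exact (QuotientAddGroup.eq_zero_iff z).1 this.symm

/-- `RightFlat` tests modules in one fixed universe; isomorphic copies there carry its conclusion to
the universe of N and N'. -/
theorem RightFlat.map_injective {R : Type u} {M : Type v} [Ring R] [AddCommGroup M] [Module Rᵐᵒᵖ M]
    (h : RightFlat R M) {N N' : Type w} [AddCommGroup N] [Module R N] [AddCommGroup N']
    [Module R N'] {f : N →ₗ[R] N'} (hf : Function.Injective f)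
    (e : ∀ (P : Type w) [AddCommGroup P] [Module R P], ∃ (Q : Type (max u v)) (_ : AddCommGroup Q)
      (_ : Module R Q), Nonempty (P ≃ₗ[R] Q)) :
    Function.Injective (NTensor.map (LinearMap.id : M →ₗ[Rᵐᵒᵖ] M) f) := by
  obtain ⟨Q, _, _, ⟨a⟩⟩ := e N
  obtain ⟨Q', _, _, ⟨a'⟩⟩ := e N'
  intro z z' hz
  have key : NTensor.map (LinearMap.id : M →ₗ[Rᵐᵒᵖ] M) a.toLinearMap z =
      NTensor.map LinearMap.id a.toLinearMap z' := by
    refine h Q Q' (a'.toLinearMap ∘ₗ f ∘ₗ a.symm.toLinearMap)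
      (a'.injective.comp (hf.comp a.symm.injective)) ?_
    have h₁ : (a'.toLinearMap ∘ₗ f ∘ₗ a.symm.toLinearMap) ∘ₗ a.toLinearMap = a'.toLinearMap ∘ₗ f := by
      ext n; simp
    rw [NTensor.map_map, NTensor.map_map, h₁]
    have h₂ := congrArg (NTensor.map (LinearMap.id : M →ₗ[Rᵐᵒᵖ] M) a'.toLinearMap) hz
    rwa [NTensor.map_map, NTensor.map_map] at h₂
  have h₃ := congrArg (NTensor.map (LinearMap.id : M →ₗ[Rᵐᵒᵖ] M) a.symm.toLinearMap) key
  have h₄ : a.symm.toLinearMap ∘ₗ a.toLinearMap = LinearMap.id := by ext n; simp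
  rwa [NTensor.map_map, NTensor.map_map, h₄, LinearMap.id_comp, NTensor.map_id,
    NTensor.map_id] at h₃

end RightExact

theorem exists_linearEquiv_lift (P : Type w) [AddCommGroup P] [Module B P] :
    ∃ (Q : Type (max v u w)) (_ : AddCommGroup Q) (_ : Module B Q), Nonempty (P ≃ₗ[B] Q) :=
  ⟨ULift.{max v u} P, inferInstance, inferInstance, ⟨ULift.moduleEquiv.symm⟩⟩

/-! ### Case (a): from flatness of Σ^* to exactness of S ⊗_B - -/

section Detect

variable {N : Type*} [AddCommGroup N] [Module B N]

/-- This exhibits S as a direct summand of a finite power of Σ^* as a right B-module: s ↦ (e_i^*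
s)_i is split by (f_i) ↦ ∑ e_i f_i. It is stated after tensoring with N. -/
theorem DualBasis.sum_map_postcomp (D : DualBasis A Sig) (z : NTensor B (EndRing A Sig) N) :
    ∑ i, NTensor.map (postcomp B (ray (D.vec i))) LinearMap.id
      (NTensor.map (postcomp B (D.covec i)) LinearMap.id z) = z := by
  induction z using NTensor.induction_on with
  | zero => simp only [map_zero, Finset.sum_const_zero]
  | tmul s n =>
    simp only [NTensor.map_tmul, postcomp_apply, LinearMap.id_apply]
    rw [← NTensor.sum_tmul]
    congr 1
    ext x
    simpa using D.sum_eq (s x)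
  | add x y hx hy => simp only [map_add, Finset.sum_add_distrib, hx, hy]

theorem DualBasis.map_postcomp_ext (D : DualBasis A Sig) {z z' : NTensor B (EndRing A Sig) N}
    (h : ∀ f : RightDual A Sig, NTensor.map (postcomp B f) LinearMap.id z =
      NTensor.map (postcomp B f) LinearMap.id z') : z = z' := by
  rw [← D.sum_map_postcomp z, ← D.sum_map_postcomp z']
  simp only [h]

end Detect

theorem DualBasis.map_injective_of_rightFlat (D : DualBasis A Sig)
    (h : RightFlat B (RightDual A Sig))
    {N N' : Type w} [AddCommGroup N] [Module B N] [AddCommGroup N'] [Module B N'] {f : N →ₗ[B] N'}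
    (hf : Function.Injective f) :
    Function.Injective (NTensor.map (LinearMap.id : EndRing A Sig →ₗ[Bᵐᵒᵖ] _) f) := by
  intro z z' hz
  refine D.map_postcomp_ext fun φ => ?_
  refine h.map_injective hf exists_linearEquiv_lift.{u, v, w} ?_
  have := congrArg (NTensor.map (postcomp B φ) LinearMap.id) hz
  rw [NTensor.map_map, NTensor.map_map] at this ⊢
  exact this

/-- Flatness gives injectivity of S ⊗ I → S ⊗ S at once. For the image, S/I embeds in S ⊗ S through
the difference of the two maps defining I; tensoring keeps this injective, and the grouplike
identity says that p dies in S ⊗ S ⊗ S. So p dies in S ⊗ S/I and comes from S ⊗ I. -/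
theorem DualBasis.mulMap_bijective_of_rightFlat (D : DualBasis A Sig)
    (h : RightFlat B (RightDual A Sig)) {I : SubBimodule B (EndRing A Sig)}
    {p : NTensor B (EndRing A Sig) (EndRing A Sig)} (hI : IsCoinvariants I p)
    (hp : mulS B A Sig p = 1)
    (hc : NTensor.map LinearMap.id (oneTmul B A Sig _) p = NTensor.map LinearMap.id (lactHom p) p) :
    Function.Bijective I.mulMap := by
  refine hI.mulMap_bijective hp (D.map_injective_of_rightFlat h I.injective_subtype) ?_
  refine NTensor.exists_map_subtype_of_map_mkQ I.toSubmodule p ?_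
  have hker : I.toSubmodule = LinearMap.ker (oneTmul B A Sig (EndRing A Sig) - lactHom p) := by
    ext t
    rw [hI t, LinearMap.mem_ker, LinearMap.sub_apply, sub_eq_zero]; rfl
  have hinj : Function.Injective
      (I.toSubmodule.liftQ (oneTmul B A Sig (EndRing A Sig) - lactHom p) hker.le) := by
    rw [← LinearMap.ker_eq_bot, Submodule.ker_liftQ_eq_bot _ _ _ hker.ge]
  refine D.map_injective_of_rightFlat h hinj ?_
  rw [NTensor.map_map, Submodule.liftQ_mkQ, map_zero, LinearMap.id_comp, NTensor.map_sub_right, hc,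
    sub_self]

/-! ### Case (b): the retraction π of B → S and its consequences -/

/-- A `B`-bimodule retraction of `B → S`. -/
theorem IsSeparableBimodule.exists_retraction (h : IsSeparableBimodule B A Sig) :
    ∃ π : BimoduleHom B B (EndRing A Sig) B, π 1 = 1 := by
  obtain ⟨σ, hσ⟩ := h
  let ev : EndRing A Sig →+ NTensor A Sig (LeftDual B Sig) →+ B :=
    AddMonoidHom.mk' (fun s => (leftEval B A Sig).comp (NTensor.map s LinearMap.id)) fun s t => by
      ext z
      simp only [AddMonoidHom.comp_apply, AddMonoidHom.add_apply]
      induction z using NTensor.induction_on with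
      | zero => simp only [map_zero, add_zero]
      | tmul x f => exact map_add f (s x) (t x)
      | add x y hx hy => simp only [map_add, hx, hy]; abel
  have hl : ∀ (b : B) s z, ev (b • s) z = b * ev s z := by
    intro b s z
    induction z using NTensor.induction_on with
    | zero => simp only [map_zero, mul_zero]
    | tmul x f => exact map_smul f b (s x)
    | add x y hx hy => simp only [map_add, mul_add, hx, hy]
  have hm : ∀ (b : B) s z, ev (op b • s) z = ev s (b • z) := by
    intro b s z
    induction z using NTensor.induction_on with
    | zero => simp only [map_zero, smul_zero]
    | tmul x f => rfl
    | add x y hx hy => simp only [map_add, smul_add, hx, hy]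
  have hr : ∀ (b : B) s z, ev s (op b • z) = ev s z * b := by
    intro b s z
    induction z using NTensor.induction_on with
    | zero => simp only [map_zero, smul_zero, zero_mul]
    | tmul x f => rfl
    | add x y hx hy => simp only [map_add, smul_add, add_mul, hx, hy]
  -- π(s) is the evaluation of (s ⊗ id)(σ(1)). Left linearity is formal. Right linearity needs b
  -- σ(1) = σ(1) b, which holds since both are σ(b).
  refine ⟨{ toFun := fun s => ev s (σ 1), map_add' := fun s t => ?_, map_smul' := fun b s => hl b s _,
            map_op_smul' := fun b s => ?_ }, ?_⟩
  · rw [map_add]; rfl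
  · change ev (op b • s) (σ 1) = ev s (σ 1) * b
    have hb : b • σ 1 = op b • σ 1 := by
      refine (map_smul σ.left b 1).symm.trans (Eq.trans ?_ (map_smul σ.right (op b) 1))
      change σ (b * 1) = σ (1 * b)
      rw [mul_one, one_mul]
    rw [hm, ← hr, hb]
  · refine Eq.trans ?_ (hσ 1)
    change leftEval B A Sig (NTensor.map LinearMap.id LinearMap.id (σ 1)) = _
    rw [NTensor.map_id]

section Retraction

variable (π : BimoduleHom B B (EndRing A Sig) B) {N N' : Type*} [AddCommGroup N] [Module B N]
  [AddCommGroup N'] [Module B N']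

/-- The map `π ⊗ N : S ⊗_B N → N`. -/
def contract : NTensor B (EndRing A Sig) N →ₗ[B] N where
  toFun z := NTensor.lid (NTensor.map π.right LinearMap.id z)
  map_add' _ _ := by rw [map_add, map_add]
  map_smul' b z := by
    induction z using NTensor.induction_on with
    | zero => simp only [smul_zero, map_zero]
    | tmul s n =>
      change π (b • s) • n = b • π s • n
      rw [← mul_smul]
      exact congrArg (· • n) (map_smul π.left b s)
    | add x y hx hy => simp only [smul_add, map_add, hx, hy]

@[simp] theorem contract_tmul (s : EndRing A Sig) (n : N) :
    contract π (NTensor.tmul B s n) = π s • n := rfl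

theorem contract_map (φ : N →ₗ[B] N') (z : NTensor B (EndRing A Sig) N) :
    contract π (NTensor.map LinearMap.id φ z) = φ (contract π z) := by
  induction z using NTensor.induction_on with
  | zero => simp only [map_zero]
  | tmul s n => simp
  | add x y hx hy => simp only [map_add, hx, hy]

variable {π} in
theorem contract_tmul_one (hπ : π 1 = 1) (n : N) :
    contract π (NTensor.tmul B (1 : EndRing A Sig) n) = n := by
  rw [contract_tmul, hπ, one_smul]

-- The map θ : t ↦ (π ⊗ S)(t p) is a B-linear projection of S onto I. A split inclusion stays
-- injective after tensoring, and (S ⊗ θ)(p) is the required preimage of p.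
variable {π} in
theorem IsCoinvariants.mulMap_bijective_of_retraction (hπ : π 1 = 1)
    {I : SubBimodule B (EndRing A Sig)}
    {p : NTensor B (EndRing A Sig) (EndRing A Sig)} (hI : IsCoinvariants I p)
    (hp : mulS B A Sig p = 1)
    (hc : NTensor.map LinearMap.id (oneTmul B A Sig _) p = NTensor.map LinearMap.id (lactHom p) p) :
    Function.Bijective I.mulMap := by
  have hmem : ∀ t, contract π (lactHom p t) ∈ I.toSubmodule := fun t => by
    -- Multiplying the grouplike identity by t on the left and applying π to the first factor gives
    -- 1 ⊗ θ(t) = θ(t) p, the equation defining I.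
    have h := congrArg (fun z => contract π (lactHom z t)) hc
    simp only [← map_lactHom, contract_map] at h
    exact (hI _).2 h
  let θ : EndRing A Sig →ₗ[B] I.toSubmodule :=
    (contract π ∘ₗ lactHom p).codRestrict I.toSubmodule hmem
  have hθ : θ ∘ₗ I.toSubmodule.subtype = LinearMap.id := by
    ext1 t
    refine Subtype.ext ?_
    change contract π (lactHom p (t : EndRing A Sig)) = t
    rw [← (hI t).1 t.2, contract_tmul_one hπ]
  refine hI.mulMap_bijective hp (fun z z' h => ?_) ⟨NTensor.map LinearMap.id θ p, ?_⟩
  · have h₁ := congrArg (NTensor.map LinearMap.id θ) h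
    rwa [NTensor.map_map, NTensor.map_map, hθ, LinearMap.id_comp, NTensor.map_id,
      NTensor.map_id] at h₁
  · have h₁ : I.toSubmodule.subtype ∘ₗ θ = contract π ∘ₗ lactHom p := rfl
    have h₂ : contract π ∘ₗ oneTmul B A Sig (EndRing A Sig) = LinearMap.id := by
      ext1 t
      exact contract_tmul_one hπ t
    -- Applying π to the middle factor: the grouplike identity replaces ∑ s ⊗ t p by ∑ s ⊗ 1 ⊗ t,
    -- and π(1) = 1 leaves p.
    rw [NTensor.map_map, h₁, ← NTensor.map_map LinearMap.id (contract π), ← hc, NTensor.map_map, h₂]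
    exact NTensor.map_id p

end Retraction

/-! ### From a sub-bimodule I to its grouplike tensor p_I, and back -/

section Converse

variable (I : leftSubBimodules B A Sig)

/-- The image of `m⁻¹(1)` in `S ⊗_B S`. -/
noncomputable def unitTensor : NTensor B (EndRing A Sig) (EndRing A Sig) :=
  NTensor.map LinearMap.id I.1.toSubmodule.subtype ((mulEquiv I).symm 1)

theorem mulMap_symm_one : I.1.mulMap ((mulEquiv I).symm 1) = 1 := (mulEquiv I).apply_symm_apply 1

theorem mulS_unitTensor : mulS B A Sig (unitTensor I) = 1 := by
  rw [unitTensor, mulS_map_subtype, mulMap_symm_one]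

-- A p that multiplies with I as its coinvariants is forced: m^{-1}(1) has image m(m^{-1}(1)) p = p.
-- This recovers the tensor of a coring endomorphism from its Hom sub-bimodule.
variable {I} in
theorem unitTensor_eq {p : NTensor B (EndRing A Sig) (EndRing A Sig)} (h : IsCoinvariants I.1 p) :
    unitTensor I = p := by
  rw [unitTensor, h.map_eq, mulMap_symm_one, lactHom_one]

/-- Both sides multiply to x, and multiplication is injective on S ⊗_B I. -/
theorem one_tmul_eq (x : I.1.toSubmodule) :
    NTensor.tmul B 1 x = lactHom ((mulEquiv I).symm 1) (x : EndRing A Sig) := by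
  refine I.2.1 ?_
  rw [mulMap_lactHom, mulMap_symm_one, mul_one, SubBimodule.mulMap_tmul, one_mul]

theorem one_tmul_eq_of_mem {t : EndRing A Sig} (ht : t ∈ I.1.toSubmodule) :
    NTensor.tmul B 1 t = lactHom (unitTensor I) t := by
  rw [unitTensor, ← map_lactHom, ← one_tmul_eq I ⟨t, ht⟩]
  rfl

/-- The second leg of p_I lies in I, and there 1 ⊗ x = x p_I. -/
theorem unitTensor_comul : NTensor.map LinearMap.id (oneTmul B A Sig _) (unitTensor I) =
    NTensor.map LinearMap.id (lactHom (unitTensor I)) (unitTensor I) := by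
  have h : oneTmul B A Sig (EndRing A Sig) ∘ₗ I.1.toSubmodule.subtype =
      lactHom (unitTensor I) ∘ₗ I.1.toSubmodule.subtype := by
    ext1 x
    exact one_tmul_eq_of_mem I x.2
  conv_lhs => rw [unitTensor, NTensor.map_map, h, ← NTensor.map_map]
  rfl

/-- Left and right multiplication of m^{-1}(1) by b have the same product, b times the identity, so
they agree already in S ⊗_B I. This centrality makes f p_I u balanced over B. -/
theorem smul_unitTensor (b : B) : b • unitTensor I = op b • unitTensor I := by
  -- Right multiplication by b on I; tensored with S it serves as the right action on S ⊗_B I.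
  let c : I.1.toSubmodule →ₗ[B] I.1.toSubmodule :=
    { toFun := fun x => ⟨op b • (x : EndRing A Sig), I.1.op_smul_mem' b x.2⟩
      map_add' := fun x x' => Subtype.ext (smul_add _ _ _)
      map_smul' := fun _ _ => rfl }
  have hl : ∀ z, NTensor.map LinearMap.id I.1.toSubmodule.subtype (b • z) =
      b • NTensor.map (LinearMap.id : EndRing A Sig →ₗ[Bᵐᵒᵖ] _) I.1.toSubmodule.subtype z := by
    intro z
    induction z using NTensor.induction_on with
    | zero => simp only [smul_zero, map_zero]
    | tmul s x => rfl
    | add x y hx hy => simp only [smul_add, map_add, hx, hy]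
  have hr : ∀ z, NTensor.map LinearMap.id I.1.toSubmodule.subtype
      (NTensor.map LinearMap.id c z) =
      op b • NTensor.map (LinearMap.id : EndRing A Sig →ₗ[Bᵐᵒᵖ] _) I.1.toSubmodule.subtype z := by
    intro z
    induction z using NTensor.induction_on with
    | zero => simp only [smul_zero, map_zero]
    | tmul s x => rfl
    | add x y hx hy => simp only [smul_add, map_add, hx, hy]
  have ml : ∀ z, I.1.mulMap (b • z) = b • I.1.mulMap z := by
    intro z
    induction z using NTensor.induction_on with
    | zero => simp only [smul_zero, map_zero]
    | tmul s x => rfl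
    | add x y hx hy => simp only [smul_add, map_add, hx, hy]
  have mr : ∀ z, I.1.mulMap (NTensor.map LinearMap.id c z) = op b • I.1.mulMap z := by
    intro z
    induction z using NTensor.induction_on with
    | zero => simp only [smul_zero, map_zero]
    | tmul s x => rfl
    | add x y hx hy => simp only [smul_add, map_add, hx, hy]
  rw [unitTensor, ← hl, ← hr]
  congr 1
  refine I.2.1 ?_
  rw [ml, mr, mulMap_symm_one]
  rfl

/-- Flatness makes multiplication bijective for J as well as for I ⊆ J, so S ⊗ I → S ⊗ J is onto and
S ⊗ J/I should vanish. Faithful flatness of Σ^* then kills J/I. -/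
theorem DualBasis.eq_of_isCoinvariants_of_rightFaithfullyFlat (D : DualBasis A Sig)
    (h : RightFaithfullyFlat B (RightDual A Sig))
    {J : SubBimodule B (EndRing A Sig)} (hJ : IsCoinvariants J (unitTensor I)) : J = I.1 := by
  have hle : I.1.toSubmodule ≤ J.toSubmodule := fun t ht => (hJ t).2 (one_tmul_eq_of_mem I ht)
  have hbij := D.mulMap_bijective_of_rightFlat h.1 hJ (mulS_unitTensor I) (unitTensor_comul I)
  let K : Submodule B J.toSubmodule := I.1.toSubmodule.submoduleOf J.toSubmodule
  let j : I.1.toSubmodule →ₗ[B] J.toSubmodule := Submodule.inclusion hle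
  have hj : K.mkQ ∘ₗ j = 0 := by
    ext1 x
    exact (Submodule.Quotient.mk_eq_zero K).2 x.2
  have hmul : ∀ z, J.mulMap (NTensor.map LinearMap.id j z) = I.1.mulMap z := by
    intro z
    induction z using NTensor.induction_on with
    | zero => simp only [map_zero]
    | tmul s x => rfl
    | add x y hx hy => simp only [map_add, hx, hy]
  have hz : ∀ x : J.toSubmodule, NTensor.tmul B (1 : EndRing A Sig) (K.mkQ x) = 0 := by
    intro x
    -- In S ⊗ J, the elements 1 ⊗ x and x m_I^{-1}(1) have the same product x, so 1 ⊗ x comes from S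
    -- ⊗ I.
    have hx : NTensor.tmul B (1 : EndRing A Sig) x =
        NTensor.map LinearMap.id j (lactHom ((mulEquiv I).symm 1) (x : EndRing A Sig)) := by
      refine hbij.1 ?_
      rw [hmul, mulMap_lactHom, mulMap_symm_one, mul_one, SubBimodule.mulMap_tmul, one_mul]
    have h₁ := congrArg (NTensor.map LinearMap.id K.mkQ) hx
    rwa [NTensor.map_map, hj, NTensor.map_zero_right] at h₁
  have hf : ∀ (f : RightDual A Sig) (q : J.toSubmodule ⧸ K), NTensor.tmul B f q = 0 := by
    intro f q
    obtain ⟨x, rfl⟩ := K.mkQ_surjective q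
    -- Composing the first leg with f turns 1 ⊗ q = 0 into f ⊗ q = 0 in Σ^* ⊗ J/I.
    have h₁ := congrArg (NTensor.map (postcomp B f) LinearMap.id) (hz x)
    rwa [map_zero] at h₁
  obtain ⟨Q, _, _, ⟨e⟩⟩ := exists_linearEquiv_lift.{u, v, w} (B := B) (J.toSubmodule ⧸ K)
  have hQ : ∀ z : NTensor B (RightDual A Sig) Q, z = 0 := by
    intro z
    induction z using NTensor.induction_on with
    | zero => rfl
    | tmul f q =>
      have h₁ := congrArg (NTensor.map LinearMap.id e.toLinearMap) (hf f (e.symm q))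
      rw [map_zero, NTensor.map_tmul] at h₁
      rw [← h₁]
      simp
    | add x y hx hy => rw [hx, hy, add_zero]
  have hs : Subsingleton Q := h.2 Q ⟨fun z z' => (hQ z).trans (hQ z').symm⟩
  refine SubBimodule.ext fun t => ⟨fun ht => ?_, fun ht => hle ht⟩
  exact (Submodule.Quotient.mk_eq_zero K (x := ⟨t, ht⟩)).1 (e.injective (Subsingleton.elim _ _))

-- Applying π ⊗ S to 1 ⊗ t = t p_I gives t on the left, and an element of I on the right, because
-- the second leg of p_I lies in I.
variable {I} in
theorem eq_of_isCoinvariants_of_retraction {π : BimoduleHom B B (EndRing A Sig) B} (hπ : π 1 = 1)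
    {J : SubBimodule B (EndRing A Sig)} (hJ : IsCoinvariants J (unitTensor I)) : J = I.1 := by
  refine SubBimodule.ext fun t => ⟨fun ht => ?_, fun ht => (hJ t).2 (one_tmul_eq_of_mem I ht)⟩
  rw [← contract_tmul_one hπ t, (hJ t).1 ht, unitTensor, ← map_lactHom, contract_map]
  exact Subtype.prop _

end Converse

/-! ### Bimodule endomorphisms of Σ^* ⊗_B Σ as elements of S ⊗_B S -/

variable (B) in
/-- The map `s ⊗ t ↦ f s ⊗ t u`. -/
def sandwich (f : RightDual A Sig) (u : Sig) :
    NTensor B (EndRing A Sig) (EndRing A Sig) →+ ComatrixBimodule B A Sig :=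
  NTensor.map (postcomp B f) (evalAt B u)

@[simp] theorem sandwich_tmul (f : RightDual A Sig) (u : Sig) (s t : EndRing A Sig) :
    sandwich B f u (NTensor.tmul B s t) = NTensor.tmul B (f ∘ₗ s) (t u) := rfl

variable (B) in
/-- The map `f ⊗ u ↦ x f ⊗ u h`. -/
def wrap (x : Sig) (h : RightDual A Sig) :
    ComatrixBimodule B A Sig →+ NTensor B (EndRing A Sig) (EndRing A Sig) :=
  NTensor.map (postcomp B (ray x)) (outer B h)

@[simp] theorem wrap_tmul (x : Sig) (h f : RightDual A Sig) (u : Sig) :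
    wrap B x h (NTensor.tmul B f u) = NTensor.tmul B (ray x ∘ₗ f) (ray u ∘ₗ h) := rfl

/-- Sandwiching x c h between f and u leaves the scalars f(x) and h(u) around c. This reduces
`DualBasis.sandwich_tensorOf` to A-bilinearity of g and the dual basis expansion of f ⊗ u. -/
theorem sandwich_wrap (f h : RightDual A Sig) (u x : Sig) (c : ComatrixBimodule B A Sig) :
    sandwich B f u (wrap B x h c) = f x • op (h u) • c := by
  induction c using NTensor.induction_on with
  | zero => simp only [smul_zero, map_zero]
  | tmul f' u' =>
    rw [wrap_tmul, sandwich_tmul, NTensor.right_smul_tmul, NTensor.left_smul_tmul]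
    congr 1
    ext y
    simp
  | add x y hx hy => simp only [smul_add, map_add, hx, hy]

namespace DualBasis

variable (D : DualBasis A Sig)

theorem sum_smul_tmul_smul (f : RightDual A Sig) (u : Sig) :
    ∑ i, ∑ j, f (D.vec i) • op (D.covec j u) • NTensor.tmul B (D.covec i) (D.vec j) =
      NTensor.tmul B f u := by
  conv_rhs => rw [← D.sum_covec f, NTensor.sum_tmul]
  refine Finset.sum_congr rfl fun i _ => ?_
  conv_rhs => rw [← D.sum_eq u, NTensor.tmul_sum]
  rfl

theorem sum_wrap_sandwich (z : NTensor B (EndRing A Sig) (EndRing A Sig)) :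
    ∑ i, ∑ j, wrap B (D.vec i) (D.covec j) (sandwich B (D.covec i) (D.vec j) z) = z := by
  induction z using NTensor.induction_on with
  | zero => simp only [map_zero, Finset.sum_const_zero]
  | tmul s t =>
    simp only [sandwich_tmul, wrap_tmul, ← NTensor.tmul_sum]
    have h : ∑ j, ray (t (D.vec j)) ∘ₗ D.covec j = t := D.sum_outer (B := B) t
    rw [h, ← NTensor.sum_tmul]
    congr 1
    ext x
    simpa using D.sum_eq (s x)
  | add x y hx hy => simp only [map_add, Finset.sum_add_distrib, hx, hy]

/-- The element of `S ⊗_B S` representing a bimodule endomorphism of `Σ^* ⊗_B Σ`. -/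
def tensorOf (g : BimoduleHom A A (ComatrixBimodule B A Sig) (ComatrixBimodule B A Sig)) :
    NTensor B (EndRing A Sig) (EndRing A Sig) :=
  ∑ i, ∑ j, wrap B (D.vec i) (D.covec j) (g (NTensor.tmul B (D.covec i) (D.vec j)))

theorem sandwich_tensorOf
    (g : BimoduleHom A A (ComatrixBimodule B A Sig) (ComatrixBimodule B A Sig))
    (f : RightDual A Sig) (u : Sig) :
    sandwich B f u (D.tensorOf g) = g (NTensor.tmul B f u) := by
  rw [tensorOf]
  conv_rhs => rw [← D.sum_smul_tmul_smul f u]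
  simp only [map_sum, sandwich_wrap]
  refine Finset.sum_congr rfl fun i _ => Finset.sum_congr rfl fun j _ => ?_
  rw [map_smul]
  congr 1
  exact (g.map_op_smul' _ _).symm

/-- Moving an endomorphism of `Σ_A` across the dual basis. -/
theorem sum_tmul_comp (t : EndRing A Sig) (y : Sig) :
    ∑ i, NTensor.tmul A (D.vec i) (NTensor.tmul B (D.covec i ∘ₗ t) y) =
      ∑ i, NTensor.tmul A (t (D.vec i)) (NTensor.tmul B (D.covec i) y) := by
  have h₁ : ∀ i, NTensor.tmul A (t (D.vec i)) (NTensor.tmul B (D.covec i) y) =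
      ∑ j, NTensor.tmul A (D.vec j)
        (NTensor.tmul B (D.covec j (t (D.vec i)) • D.covec i) y) := fun i => by
    conv_lhs => rw [← D.sum_eq (t (D.vec i)), NTensor.sum_tmul]
    exact Finset.sum_congr rfl fun j _ => NTensor.smul_tmul A _ _ _
  rw [Finset.sum_congr rfl fun i _ => h₁ i, Finset.sum_comm]
  refine Finset.sum_congr rfl fun j _ => ?_
  rw [← NTensor.tmul_sum, ← NTensor.sum_tmul]
  congr 2
  exact (D.sum_covec (D.covec j ∘ₗ t)).symm

variable (B) in
/-- The map `S ⊗_B Σ → Σ ⊗_A C`, `t ⊗ y ↦ ∑ e_i ⊗ (e_i^* t ⊗ y)`. -/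
def unfold : NTensor B (EndRing A Sig) Sig →+ NTensor A Sig (ComatrixBimodule B A Sig) :=
  ∑ i, (NTensor.mk A (D.vec i)).comp (NTensor.map (postcomp B (D.covec i)) LinearMap.id)

theorem unfold_apply (z : NTensor B (EndRing A Sig) Sig) : D.unfold B z =
    ∑ i, NTensor.tmul A (D.vec i) (NTensor.map (postcomp B (D.covec i)) LinearMap.id z) := by
  rw [unfold, AddMonoidHom.finsetSum_apply]
  rfl

theorem unfold_tmul (t : EndRing A Sig) (y : Sig) : D.unfold B (NTensor.tmul B t y) =
    ∑ i, NTensor.tmul A (t (D.vec i)) (NTensor.tmul B (D.covec i) y) := by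
  rw [unfold_apply, ← D.sum_tmul_comp]
  rfl

/-- Under the identification of S ⊗_B Σ with Σ ⊗_A C, the element 1 ⊗ y becomes ρ(y). Coactions can
thus be compared in S ⊗_B Σ, free of dual basis sums. -/
theorem unfold_tmul_coact (t : EndRing A Sig) (y : Sig) : D.unfold B (NTensor.tmul B t y) =
    NTensor.map t LinearMap.id (coactHom B D y) := by
  rw [unfold_tmul, coactHom_apply, map_sum]
  rfl

theorem unfold_lactHom (w : NTensor B (EndRing A Sig) Sig) (t : EndRing A Sig) :
    D.unfold B (lactHom w t) = NTensor.map t LinearMap.id (D.unfold B w) := by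
  induction w using NTensor.induction_on with
  | zero => simp only [lactHom_zero, LinearMap.zero_apply, map_zero]
  | tmul s y =>
    rw [lactHom_tmul, unfold_tmul_coact, unfold_tmul_coact, NTensor.map_map]
    rfl
  | add x y hx hy => simp only [lactHom_add, LinearMap.add_apply, map_add, hx, hy]

end DualBasis

variable (B A Sig) in
/-- The map `Σ ⊗_A C → S ⊗_B Σ`, `x ⊗ (f ⊗ y) ↦ x f ⊗ y`. -/
def fold : NTensor A Sig (ComatrixBimodule B A Sig) →ₗ[B] NTensor B (EndRing A Sig) Sig where
  toFun := NTensor.lift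
    (AddMonoidHom.mk' (fun x => NTensor.map (postcomp B (ray x)) LinearMap.id) fun x y => by
      refine NTensor.hom_ext fun f u => ?_
      refine Eq.trans ?_ (NTensor.add_tmul B (ray x ∘ₗ f) (ray y ∘ₗ f) u)
      refine congrArg (fun s => NTensor.tmul B s u) ?_
      ext z
      simp)
    fun x a c => by
      induction c using NTensor.induction_on with
      | zero => simp only [smul_zero, map_zero]
      | tmul f u =>
        refine congrArg (fun s => NTensor.tmul B s u) ?_
        ext z
        simp [mul_smul]
      | add x y hx hy => simp only [smul_add, map_add, hx, hy]
  map_add' := map_add _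
  map_smul' b z := by
    induction z using NTensor.induction_on with
    | zero => simp only [smul_zero, map_zero]
    | add x y hx hy => simp only [smul_add, map_add, hx, hy]
    | tmul x c =>
      rw [RingHom.id_apply, NTensor.left_smul_tmul, NTensor.lift_tmul, NTensor.lift_tmul]
      induction c using NTensor.induction_on with
      | zero => simp only [smul_zero, map_zero]
      | tmul f u =>
        refine congrArg (fun s => NTensor.tmul B s u) ?_
        ext z
        exact smul_comm _ _ _
      | add x y hx hy => simp only [smul_add, map_add, hx, hy]

theorem DualBasis.fold_unfold (D : DualBasis A Sig) (z : NTensor B (EndRing A Sig) Sig) :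
    fold B A Sig (D.unfold B z) = z := by
  rw [unfold_apply, map_sum]
  exact D.sum_map_postcomp z

theorem DualBasis.unfold_injective (D : DualBasis A Sig) : Function.Injective (D.unfold B) :=
  Function.LeftInverse.injective D.fold_unfold

/-- A bimodule endomorphism `g` of `Σ^* ⊗_B Σ` is represented by `p ∈ S ⊗_B S` if
`g(f ⊗ u) = f p u`. -/
def Represents (p : NTensor B (EndRing A Sig) (EndRing A Sig))
    (g : BimoduleHom A A (ComatrixBimodule B A Sig) (ComatrixBimodule B A Sig)) : Prop :=
  ∀ f u, g (NTensor.tmul B f u) = sandwich B f u p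

/-! ### Colinear maps Σ_g → Σ as coinvariants of p -/

section Colinear

variable (D : DualBasis A Sig)

/-- A tensor is rebuilt from its evaluations at the e_j, because t = ∑ t(e_j) e_j^*. -/
theorem map_evalAt_ext {N : Type*} [AddCommGroup N] [Module Bᵐᵒᵖ N] (D : DualBasis A Sig)
    {z z' : NTensor B N (EndRing A Sig)}
    (h : ∀ u, NTensor.map LinearMap.id (evalAt B u) z = NTensor.map LinearMap.id (evalAt B u) z') :
    z = z' := by
  have key : ∀ z : NTensor B N (EndRing A Sig), ∑ j, NTensor.map LinearMap.id
      (outer B (D.covec j)) (NTensor.map LinearMap.id (evalAt B (D.vec j)) z) = z := by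
    intro z
    induction z using NTensor.induction_on with
    | zero => simp only [map_zero, Finset.sum_const_zero]
    | tmul n t =>
      simp only [NTensor.map_tmul, LinearMap.id_apply, evalAt_apply]
      rw [← NTensor.tmul_sum, D.sum_outer]
    | add x y hx hy => simp only [map_add, Finset.sum_add_distrib, hx, hy]
  rw [← key z, ← key z']
  simp only [h]

theorem Represents.map_coact {p : NTensor B (EndRing A Sig) (EndRing A Sig)}
    {g : BimoduleHom A A (ComatrixBimodule B A Sig) (ComatrixBimodule B A Sig)}
    (hg : Represents p g) (u : Sig) :
    NTensor.map LinearMap.id g.left (coactHom B D u) =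
      D.unfold B (NTensor.map LinearMap.id (evalAt B u) p) := by
  rw [coactHom_apply, map_sum, D.unfold_apply]
  refine Finset.sum_congr rfl fun i _ => ?_
  rw [NTensor.map_tmul, NTensor.map_map]
  exact congrArg (NTensor.tmul A (D.vec i)) (hg _ _)

/-- In S ⊗_B Σ the two sides of colinearity at u are 1 ⊗ t u and t p u, that is, the evaluations at
u of 1 ⊗ t and t p; these evaluations separate elements of S ⊗_B S. -/
theorem Represents.colinear_iff {p : NTensor B (EndRing A Sig) (EndRing A Sig)}
    {g : BimoduleHom A A (ComatrixBimodule B A Sig) (ComatrixBimodule B A Sig)}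
    (hg : Represents p g) (t : EndRing A Sig) :
    (∀ u, coactHom B D (t u) =
      NTensor.map t LinearMap.id (NTensor.map LinearMap.id g.left (coactHom B D u))) ↔
    NTensor.tmul B 1 t = lactHom p t := by
  have h₁ : ∀ u, coactHom B D (t u) = D.unfold B
      (NTensor.map LinearMap.id (evalAt B u) (NTensor.tmul B 1 t)) := fun u => by
    rw [NTensor.map_tmul, LinearMap.id_apply, evalAt_apply, D.unfold_tmul_coact]
    exact (NTensor.map_id _).symm
  have h₂ : ∀ u, NTensor.map t LinearMap.id (NTensor.map LinearMap.id g.left (coactHom B D u)) =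
      D.unfold B (NTensor.map LinearMap.id (evalAt B u) (lactHom p t)) := fun u => by
    rw [hg.map_coact D, map_lactHom, D.unfold_lactHom]
  simp only [h₁, h₂]
  exact ⟨fun h => map_evalAt_ext D fun u => D.unfold_injective (h u), fun h u => by rw [h]⟩

theorem Represents.isCoinvariants [Module.Finite Aᵐᵒᵖ Sig] [Module.Projective Aᵐᵒᵖ Sig]
    {p : NTensor B (EndRing A Sig) (EndRing A Sig)}
    {g : CoringHom (comatrixCoring B A Sig) (comatrixCoring B A Sig)}
    (hg : Represents p g.toBimoduleHom) : IsCoinvariants (colinearHoms B g) p :=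
  hg.colinear_iff (dualBasis A Sig)

end Colinear

/-! ### Comultiplication and counit conditions on p -/

section Comul

theorem insertLeft_smul (f : RightDual A Sig) (b : B)
    (z : NTensor A Sig (ComatrixBimodule B A Sig)) :
    insertLeft (op b • f) z = insertLeft f (b • z) := by
  induction z using NTensor.induction_on with
  | zero => simp only [smul_zero, map_zero]
  | tmul x c => exact congrArg (fun d => NTensor.tmul A d c) (NTensor.smul_tmul B f b x)
  | add x y hx hy => simp only [smul_add, map_add, hx, hy]

variable (D : DualBasis A Sig)

theorem DualBasis.unfold_smul (b : B) (w : NTensor B (EndRing A Sig) Sig) :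
    D.unfold B (b • w) = b • D.unfold B w := by
  induction w using NTensor.induction_on with
  | zero => simp only [smul_zero, map_zero]
  | tmul t y =>
    rw [NTensor.left_smul_tmul, D.unfold_tmul, D.unfold_tmul, Finset.smul_sum]
    rfl
  | add x y hx hy => simp only [smul_add, map_add, hx, hy]

/-- The map `S ⊗_B (S ⊗_B Σ) → C ⊗_A C`, `s ⊗ (t ⊗ y) ↦ ∑ (f s ⊗ e_i) ⊗ (e_i^* t ⊗ y)`. -/
def splitSandwich (f : RightDual A Sig) :
    NTensor B (EndRing A Sig) (NTensor B (EndRing A Sig) Sig) →+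
      NTensor A (ComatrixBimodule B A Sig) (ComatrixBimodule B A Sig) :=
  NTensor.lift
    (AddMonoidHom.mk' (fun s => (insertLeft (f ∘ₗ s)).comp (D.unfold B)) fun s t => by
      ext w
      simp only [AddMonoidHom.comp_apply, AddMonoidHom.add_apply]
      generalize D.unfold B w = z
      induction z using NTensor.induction_on with
      | zero => simp only [map_zero, add_zero]
      | tmul x c =>
        rw [LinearMap.comp_add]
        exact (congrArg (fun d => NTensor.tmul A d c)
          (NTensor.add_tmul B (f ∘ₗ s) (f ∘ₗ t) x)).trans (NTensor.add_tmul A _ _ _)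
      | add x y hx hy => simp only [map_add, hx, hy]; abel)
    fun s b w => by
      change insertLeft (op b • (f ∘ₗ s)) (D.unfold B w) = insertLeft (f ∘ₗ s) (D.unfold B (b • w))
      rw [insertLeft_smul, D.unfold_smul]

theorem splitSandwich_tmul (f : RightDual A Sig) (s : EndRing A Sig)
    (w : NTensor B (EndRing A Sig) Sig) :
    splitSandwich D f (NTensor.tmul B s w) = insertLeft (f ∘ₗ s) (D.unfold B w) := rfl

/-- The map `C ⊗_A C → S ⊗_B (S ⊗_B Σ)`, `(f ⊗ u) ⊗ (f' ⊗ y) ↦ x f ⊗ (u f' ⊗ y)`. -/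
def splitWrap (x : Sig) : NTensor A (ComatrixBimodule B A Sig) (ComatrixBimodule B A Sig) →+
    NTensor B (EndRing A Sig) (NTensor B (EndRing A Sig) Sig) :=
  ((NTensor.map LinearMap.id (fold B A Sig)).comp NTensor.assoc).comp
    (NTensor.map
      ({ toFun := NTensor.map (postcomp B (ray x)) LinearMap.id
         map_add' := map_add _
         map_smul' := fun a z => by
          induction z using NTensor.induction_on with
          | zero => simp only [smul_zero, map_zero]
          | tmul f u => rfl
          | add x y hx hy => simp only [smul_add, map_add, hx, hy] } :
        ComatrixBimodule B A Sig →ₗ[Aᵐᵒᵖ] NTensor B (EndRing A Sig) Sig)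
      LinearMap.id)

theorem splitWrap_insertLeft (x : Sig) (f : RightDual A Sig)
    (z : NTensor A Sig (ComatrixBimodule B A Sig)) :
    splitWrap x (insertLeft f z) = NTensor.tmul B (ray x ∘ₗ f) (fold B A Sig z) := by
  induction z using NTensor.induction_on with
  | zero => simp only [map_zero, NTensor.tmul_zero]
  | tmul u c => rfl
  | add x y hx hy => simp only [map_add, NTensor.tmul_add, hx, hy]

/-- The maps `splitSandwich D (D.covec i)` are jointly injective, so an identity in C ⊗_A C for all
f descends to S ⊗_B (S ⊗_B Σ). -/
theorem sum_splitWrap_splitSandwich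
    (z : NTensor B (EndRing A Sig) (NTensor B (EndRing A Sig) Sig)) :
    ∑ i, splitWrap (D.vec i) (splitSandwich D (D.covec i) z) = z := by
  induction z using NTensor.induction_on with
  | zero => simp only [map_zero, Finset.sum_const_zero]
  | tmul s w =>
    simp only [splitSandwich_tmul, splitWrap_insertLeft, D.fold_unfold]
    rw [← NTensor.sum_tmul]
    congr 1
    ext x
    simpa using D.sum_eq (s x)
  | add x y hx hy => simp only [map_add, Finset.sum_add_distrib, hx, hy]

variable (B) in
/-- The map `S ⊗_B S → S ⊗_B Σ` evaluating at `u`, as a left `B`-linear map. -/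
def evalRight (u : Sig) :
    NTensor B (EndRing A Sig) (EndRing A Sig) →ₗ[B] NTensor B (EndRing A Sig) Sig where
  toFun := NTensor.map LinearMap.id (evalAt B u)
  map_add' := map_add _
  map_smul' b z := by
    induction z using NTensor.induction_on with
    | zero => simp only [smul_zero, map_zero]
    | tmul s t => rfl
    | add x y hx hy => simp only [smul_add, map_add, hx, hy]

theorem evalRight_ext (D : DualBasis A Sig)
    {z z' : NTensor B (EndRing A Sig) (NTensor B (EndRing A Sig) (EndRing A Sig))}
    (h : ∀ u, NTensor.map LinearMap.id (evalRight B u) z =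
      NTensor.map LinearMap.id (evalRight B u) z') : z = z' := by
  let o : RightDual A Sig → NTensor B (EndRing A Sig) Sig →ₗ[B]
      NTensor B (EndRing A Sig) (EndRing A Sig) := fun f =>
    { toFun := NTensor.map LinearMap.id (outer B f)
      map_add' := map_add _
      map_smul' := fun b z => by
        induction z using NTensor.induction_on with
        | zero => simp only [smul_zero, map_zero]
        | tmul s t => rfl
        | add x y hx hy => simp only [smul_add, map_add, hx, hy] }
  have ho : ∀ w, ∑ j, o (D.covec j) (evalRight B (D.vec j) w) = w := by
    intro w
    induction w using NTensor.induction_on with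
    | zero => simp only [map_zero, Finset.sum_const_zero]
    | tmul s t =>
      refine Eq.trans (NTensor.tmul_sum B _ s _).symm ?_
      exact congrArg (NTensor.tmul B s) (D.sum_outer (B := B) t)
    | add x y hx hy => simp only [map_add, Finset.sum_add_distrib, hx, hy]
  have key : ∀ z : NTensor B (EndRing A Sig) (NTensor B (EndRing A Sig) (EndRing A Sig)),
      ∑ j, NTensor.map LinearMap.id (o (D.covec j))
        (NTensor.map LinearMap.id (evalRight B (D.vec j)) z) = z := by
    intro z
    induction z using NTensor.induction_on with
    | zero => simp only [map_zero, Finset.sum_const_zero]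
    | tmul s w =>
      simp only [NTensor.map_tmul, LinearMap.id_apply]
      rw [← NTensor.tmul_sum, ho]
    | add x y hx hy => simp only [map_add, Finset.sum_add_distrib, hx, hy]
  rw [← key z, ← key z']
  simp only [h]

/-- On f ⊗ u, the elements Δ(g(f ⊗ u)) and (g ⊗ g)Δ(f ⊗ u) are the images of ∑ s ⊗ 1 ⊗ t u and ∑ s ⊗
t p u under the same map `splitSandwich D f`. Varying f and u recovers both triple tensors. -/
theorem Represents.comul_iff {p : NTensor B (EndRing A Sig) (EndRing A Sig)}
    {g : BimoduleHom A A (ComatrixBimodule B A Sig) (ComatrixBimodule B A Sig)}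
    (hg : Represents p g) :
    (∀ c, comatrixComulHom B D (g c) = NTensor.map g.right g.left (comatrixComulHom B D c)) ↔
      NTensor.map LinearMap.id (oneTmul B A Sig _) p = NTensor.map LinearMap.id (lactHom p) p := by
  have h₁ : ∀ f u, comatrixComulHom B D (g (NTensor.tmul B f u)) = splitSandwich D f
      (NTensor.map LinearMap.id (evalRight B u) (NTensor.map LinearMap.id (oneTmul B A Sig _) p)) := by
    intro f u
    rw [hg]
    generalize p = z
    induction z using NTensor.induction_on with
    | zero => simp only [map_zero]
    | tmul s t =>
      change _ = insertLeft (f ∘ₗ s) (D.unfold B (NTensor.tmul B 1 (t u)))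
      rw [D.unfold_tmul, map_sum, sandwich_tmul, comatrixComulHom_tmul]
      rfl
    | add x y hx hy => simp only [map_add, hx, hy]
  have h₂ : ∀ f u, NTensor.map g.right g.left (comatrixComulHom B D (NTensor.tmul B f u)) =
      splitSandwich D f (NTensor.map LinearMap.id (evalRight B u)
        (NTensor.map LinearMap.id (lactHom p) p)) := by
    intro f u
    -- Only the p that represents the first copy of g is generalized to z; the second copy stays
    -- fixed, so both sides are additive in z.
    have h₃ : ∀ z, ∑ i, NTensor.tmul A (sandwich B f (D.vec i) z)
        (g (NTensor.tmul B (D.covec i) u)) = splitSandwich D f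
          (NTensor.map LinearMap.id (evalRight B u) (NTensor.map LinearMap.id (lactHom p) z)) := by
      intro z
      induction z using NTensor.induction_on with
      | zero => simp only [map_zero, NTensor.zero_tmul, Finset.sum_const_zero]
      | tmul s t =>
        change _ = insertLeft (f ∘ₗ s) (D.unfold B
          (NTensor.map LinearMap.id (evalAt B u) (lactHom p t)))
        rw [map_lactHom, D.unfold_lactHom, ← hg.map_coact D, coactHom_apply, map_sum, map_sum,
          map_sum]
        rfl
      | add x y hx hy => simp only [map_add, NTensor.add_tmul, Finset.sum_add_distrib, hx, hy]
    rw [← h₃, comatrixComulHom_tmul, map_sum]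
    refine Finset.sum_congr rfl fun i _ => ?_
    exact congrArg (fun c => NTensor.tmul A c _) (hg f (D.vec i))
  constructor
  · intro h
    refine evalRight_ext D fun u => ?_
    -- Each side is rebuilt from its sandwiches with the e_i^*, which agree by h.
    rw [← sum_splitWrap_splitSandwich D (NTensor.map _ (evalRight B u) _),
      ← sum_splitWrap_splitSandwich D (NTensor.map _ (evalRight B u) (NTensor.map _ (lactHom p) p))]
    simp only [← h₁, ← h₂, h]
  · intro h c
    induction c using NTensor.induction_on with
    | zero => simp only [map_zero]
    | tmul f u => rw [h₁, h₂, h]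
    | add x y hx hy => simp only [map_add, hx, hy]

theorem Represents.counit_iff {p : NTensor B (EndRing A Sig) (EndRing A Sig)}
    {g : BimoduleHom A A (ComatrixBimodule B A Sig) (ComatrixBimodule B A Sig)}
    (hg : Represents p g) (D : DualBasis A Sig) :
    (∀ c, comatrixCounit B A Sig (g c) = comatrixCounit B A Sig c) ↔ mulS B A Sig p = 1 := by
  have h₁ : ∀ f u, comatrixCounit B A Sig (g (NTensor.tmul B f u)) = f (mulS B A Sig p u) := by
    intro f u
    rw [hg]
    generalize p = z
    induction z using NTensor.induction_on with
    | zero => simp only [map_zero, LinearMap.zero_apply]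
    | tmul s t => rfl
    | add x y hx hy => simp only [map_add, LinearMap.add_apply, hx, hy]
  constructor
  · intro h
    ext u
    rw [← D.sum_eq (mulS B A Sig p u)]
    simp only [← h₁, h]
    exact D.sum_eq u
  · intro h c
    induction c using NTensor.induction_on with
    | zero => simp only [map_zero]
    | tmul f u => rw [h₁, h]; rfl
    | add x y hx hy => simp only [map_add, hx, hy]

/-- The bimodule endomorphism `f ⊗ u ↦ f p u` of `Σ^* ⊗_B Σ` for `p` centralizing `B`. -/
def sandwichHom (p : NTensor B (EndRing A Sig) (EndRing A Sig)) (hp : ∀ b : B, b • p = op b • p) :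
    BimoduleHom A A (ComatrixBimodule B A Sig) (ComatrixBimodule B A Sig) where
  toFun := NTensor.lift
    (AddMonoidHom.mk' (fun f => AddMonoidHom.mk' (fun u => sandwich B f u p) fun u u' => by
        generalize p = z
        induction z using NTensor.induction_on with
        | zero => simp only [map_zero, add_zero]
        | tmul s t => simp only [sandwich_tmul, map_add, NTensor.tmul_add]
        | add x y hx hy => simp only [map_add, hx, hy]; abel)
      fun f f' => by
        ext u
        change sandwich B (f + f') u p = sandwich B f u p + sandwich B f' u p
        generalize p = z
        induction z using NTensor.induction_on with
        | zero => simp only [map_zero, add_zero]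
        | tmul s t => simp only [sandwich_tmul, LinearMap.add_comp, NTensor.add_tmul]
        | add x y hx hy => simp only [map_add, hx, hy]; abel)
    fun f b u => by
      have hl : sandwich B (op b • f) u p = sandwich B f u (b • p) := by
        generalize p = z
        induction z using NTensor.induction_on with
        | zero => simp only [smul_zero, map_zero]
        | tmul s t => rfl
        | add x y hx hy => simp only [smul_add, map_add, hx, hy]
      have hr : sandwich B f (b • u) p = sandwich B f u (op b • p) := by
        generalize p = z
        induction z using NTensor.induction_on with
        | zero => simp only [smul_zero, map_zero]
        | tmul s t => rfl
        | add x y hx hy => simp only [smul_add, map_add, hx, hy]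
      -- Moving b from f to u amounts to replacing b p by p b, so balancedness is the centrality of
      -- p.
      exact hl.trans ((congrArg _ (hp b)).trans hr.symm)
  map_add' := map_add _
  map_smul' a c := by
    induction c using NTensor.induction_on with
    | zero => simp only [smul_zero, map_zero]
    | tmul f u =>
      change sandwich B (a • f) u p = a • sandwich B f u p
      generalize p = z
      induction z using NTensor.induction_on with
      | zero => simp only [smul_zero, map_zero]
      | tmul s t => rfl
      | add x y hx hy => simp only [smul_add, map_add, hx, hy]
    | add x y hx hy => simp only [smul_add, map_add, hx, hy]
  map_op_smul' a c := by
    change NTensor.lift _ _ _ = op a • NTensor.lift _ _ _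
    induction c using NTensor.induction_on with
    | zero => simp only [smul_zero, map_zero]
    | tmul f u =>
      change sandwich B f (op a • u) p = op a • sandwich B f u p
      generalize p = z
      induction z using NTensor.induction_on with
      | zero => simp only [smul_zero, map_zero]
      | tmul s t =>
        rw [sandwich_tmul, map_smul]; rfl
      | add x y hx hy => simp only [smul_add, map_add, hx, hy]
    | add x y hx hy => simp only [smul_add, map_add, hx, hy]

theorem represents_sandwichHom (p : NTensor B (EndRing A Sig) (EndRing A Sig))
    (hp : ∀ b : B, b • p = op b • p) : Represents p (sandwichHom p hp) := fun _ _ => rfl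

end Comul

/-! ### The monoid isomorphism -/

section Main

variable [Module.Finite Aᵐᵒᵖ Sig] [Module.Projective Aᵐᵒᵖ Sig]

/-- The coring endomorphism `Γ^l(I)`. -/
noncomputable def coringHomOf (I : leftSubBimodules B A Sig) :
    CoringHom (comatrixCoring B A Sig) (comatrixCoring B A Sig) where
  toBimoduleHom := sandwichHom (unitTensor I) (smul_unitTensor I)
  counit_comp := ((represents_sandwichHom _ _).counit_iff (dualBasis A Sig)).2 (mulS_unitTensor I)
  comul_comp := ((represents_sandwichHom _ _).comul_iff (dualBasis A Sig)).2 (unitTensor_comul I)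

theorem coringHomOf_apply (I : leftSubBimodules B A Sig) {κ : Type*} [Fintype κ]
    (s : κ → EndRing A Sig) (x : κ → I.1.toSubmodule)
    (h : (mulEquiv I).symm 1 = ∑ k, NTensor.tmul B (s k) (x k)) (f : RightDual A Sig) (u : Sig) :
    coringHomOf I (NTensor.tmul B f u) =
      ∑ k, NTensor.tmul B (f ∘ₗ s k) ((x k : EndRing A Sig) u) := by
  change sandwich B f u (unitTensor I) = _
  rw [unitTensor, h, map_sum, map_sum]
  rfl

/-- Applying Γ^l(J) first puts t_k next to f and y_k next to u; Γ^l(I) then inserts s_l and x_l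
between them. The outcome is the sandwich of ∑ t_k s_l ⊗ x_l y_k, which is m^{-1}(1) for IJ. -/
theorem coringHomOf_mul (I J : leftSubBimodules B A Sig) :
    coringHomOf (I * J) = coringHomOf I * coringHomOf J := by
  obtain ⟨m, s, x, hI⟩ := NTensor.exists_eq_sum ((mulEquiv I).symm 1)
  obtain ⟨n, t, y, hJ⟩ := NTensor.exists_eq_sum ((mulEquiv J).symm 1)
  have h : (mulEquiv (I * J)).symm 1 = ∑ k : Fin n × Fin m, NTensor.tmul B (t k.1 * s k.2)
      (⟨x k.2 * y k.1, SubBimodule.mul_mem_mul (x k.2).2 (y k.1).2⟩ : (I * J).1.toSubmodule) := by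
    rw [AddEquiv.symm_apply_eq]
    change _ = (I * J).1.mulMap _
    have h₁ : 1 = ∑ k, s k * (x k : EndRing A Sig) := by
      rw [← mulMap_symm_one I, hI, map_sum]; rfl
    have h₂ : 1 = ∑ k, t k * (y k : EndRing A Sig) := by
      rw [← mulMap_symm_one J, hJ, map_sum]; rfl
    rw [map_sum, Fintype.sum_prod_type, h₂]
    refine Finset.sum_congr rfl fun k _ => ?_
    simp only [SubBimodule.mulMap_tmul]
    -- The identity ∑ s_l x_l = 1 is inserted between t_k and y_k.
    have h₃ : t k * (y k : EndRing A Sig) =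
        t k * (∑ l, s l * (x l : EndRing A Sig)) * (y k : EndRing A Sig) := by
      rw [← h₁, mul_one]
    rw [h₃, Finset.mul_sum, Finset.sum_mul]
    simp only [mul_assoc]
  refine CoringHom.ext fun c => ?_
  rw [CoringHom.mul_apply]
  induction c using NTensor.induction_on with
  | zero => simp only [map_zero]
  | tmul f u =>
    rw [coringHomOf_apply (I * J) _ _ h, coringHomOf_apply J t y hJ, map_sum,
      Fintype.sum_prod_type]
    refine Finset.sum_congr rfl fun k _ => ?_
    rw [coringHomOf_apply I s x hI]
    rfl
  | add x y hx hy => simp only [map_add, hx, hy]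

namespace CoringHom

variable (g : CoringHom (comatrixCoring B A Sig) (comatrixCoring B A Sig))

/-- The element of `S ⊗_B S` representing a coring endomorphism. -/
noncomputable def tensor : NTensor B (EndRing A Sig) (EndRing A Sig) :=
  (dualBasis A Sig).tensorOf g.toBimoduleHom

theorem represents : Represents g.tensor g.toBimoduleHom := fun f u =>
  ((dualBasis A Sig).sandwich_tensorOf g.toBimoduleHom f u).symm

theorem mulS_tensor : mulS B A Sig g.tensor = 1 :=
  (g.represents.counit_iff (dualBasis A Sig)).1 g.counit_comp

theorem tensor_comul : NTensor.map LinearMap.id (oneTmul B A Sig _) g.tensor =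
    NTensor.map LinearMap.id (lactHom g.tensor) g.tensor :=
  (g.represents.comul_iff (dualBasis A Sig)).1 g.comul_comp

theorem isCoinvariants : IsCoinvariants (colinearHoms B g) g.tensor :=
  g.represents.isCoinvariants

end CoringHom

theorem IsCoinvariants.mulMap_bijective_of_or
    (h : RightFaithfullyFlat B (RightDual A Sig) ∨ IsSeparableBimodule B A Sig)
    {I : SubBimodule B (EndRing A Sig)}
    {p : NTensor B (EndRing A Sig) (EndRing A Sig)} (hI : IsCoinvariants I p)
    (hp : mulS B A Sig p = 1)
    (hc : NTensor.map LinearMap.id (oneTmul B A Sig _) p = NTensor.map LinearMap.id (lactHom p) p) :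
    Function.Bijective I.mulMap := by
  obtain h | h := h
  · exact (dualBasis A Sig).mulMap_bijective_of_rightFlat h.1 hI hp hc
  · obtain ⟨π, hπ⟩ := h.exists_retraction
    exact hI.mulMap_bijective_of_retraction hπ hp hc

theorem eq_of_isCoinvariants_of_or
    (h : RightFaithfullyFlat B (RightDual A Sig) ∨ IsSeparableBimodule B A Sig)
    {I : leftSubBimodules B A Sig}
    {J : SubBimodule B (EndRing A Sig)} (hJ : IsCoinvariants J (unitTensor I)) : J = I.1 := by
  obtain h | h := h
  · exact (dualBasis A Sig).eq_of_isCoinvariants_of_rightFaithfullyFlat I h hJ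
  · obtain ⟨π, hπ⟩ := h.exists_retraction
    exact eq_of_isCoinvariants_of_retraction hπ hJ

/-- `Γ^l` as an isomorphism of monoids. -/
noncomputable def coringHomEquiv
    (h : RightFaithfullyFlat B (RightDual A Sig) ∨ IsSeparableBimodule B A Sig) :
    leftSubBimodules B A Sig ≃* CoringHom (comatrixCoring B A Sig) (comatrixCoring B A Sig) where
  toFun := coringHomOf
  invFun g := ⟨colinearHoms B g,
    g.isCoinvariants.mulMap_bijective_of_or h g.mulS_tensor g.tensor_comul⟩
  -- The coinvariants of p_I are I itself: this is where faithfulness of the flat module, or the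
  -- retraction, is used to exclude a larger equalizer.
  left_inv I := Subtype.ext <|
    eq_of_isCoinvariants_of_or h (represents_sandwichHom _ (smul_unitTensor I)).isCoinvariants
  right_inv g := by
    refine CoringHom.ext fun c => ?_
    induction c using NTensor.induction_on with
    | zero => simp only [map_zero]
    | tmul f u =>
      refine Eq.trans ?_ (g.represents f u).symm
      -- The tensor rebuilt from Hom_C(Σ_g, Σ) is the one representing g, so both endomorphisms are
      -- the same sandwich.
      exact congrArg (sandwich B f u) (unitTensor_eq (I := ⟨colinearHoms B g, _⟩) g.isCoinvariants)
    | add x y hx hy => simp only [map_add, hx, hy]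
  map_mul' := coringHomOf_mul

end Main

end Comatrix
open Comatrix in
theorem mainTheorem2 {A B Sig : Type*} [Ring A] [Ring B] [AddCommGroup Sig] [Module B Sig]
    [Module Aᵐᵒᵖ Sig] [SMulCommClass Aᵐᵒᵖ B Sig] [FaithfulSMul B Sig]
    [Module.Finite Aᵐᵒᵖ Sig] [Module.Projective Aᵐᵒᵖ Sig]
    (h : RightFaithfullyFlat B (RightDual A Sig) ∨ IsSeparableBimodule B A Sig) :
    ∃ e : CoringHom (comatrixCoring B A Sig) (comatrixCoring B A Sig) ≃* leftSubBimodules B A Sig,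
      (∀ g, (e g : SubBimodule B (EndRing A Sig)) = colinearHoms B g) ∧
      ∀ (I : leftSubBimodules B A Sig) (n : ℕ) (s : Fin n → EndRing A Sig)
        (x : Fin n → I.1.toSubmodule),
        (mulEquiv I).symm 1 = ∑ k, NTensor.tmul B (s k) (x k) →
        ∀ (f : RightDual A Sig) (u : Sig),
          e.symm I (NTensor.tmul B f u) =
            ∑ k, NTensor.tmul B (f ∘ₗ s k) ((x k : EndRing A Sig) u) := by
  refine ⟨(coringHomEquiv h).symm, fun g => rfl, fun I n s x hI f u => ?_⟩
  exact coringHomOf_apply I s x hI f u
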